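/- Let $M$ be a smooth manifold of dimension $2n+1$ with a Sasakian structure $(\varphi,\xi,\eta,g)$. That is, $g$ is a smooth Riemannian metric, $\varphi$ a smooth $(1,1)$-tensor field, $\xi$ a smooth vector field and $\eta$ a smooth $1$-form with $$\varphi^2=-\mathrm{Id}+\eta\otimes\xi,\quad \eta(\xi)=1,\quad \varphi\xi=0,\quad \eta\circ\varphi=0,\quad g(\varphi X,\varphi Y)=g(X,Y)-\eta(X)\eta(Y),$$ $$d\eta(X,Y)=g(X,\varphi Y),\qquad [\varphi,\varphi]+2\,d\eta\otimes\xi=0,$$ where $d\eta(X,Y)=\tfrac12\big(X\eta(Y)-Y\eta(X)-\eta([X,Y])\big)$ and $[\varphi,\varphi](X,Y)=\varphi^2[X,Y]+[\varphi X,\varphi Y]-\varphi[\varphi X,Y]-\varphi[X,\varphi Y]$. Let $\nabla$ be the Levi-Civita connection of $g$, $R(X,Y)Z=\nabla_X\nabla_YZ-\nabla_Y\nabla_XZ-\nabla_{[X,Y]}Z$, and, for a local orthonormal frame $(e_i)$, $$\mathrm{Ric}(X,Y)=\sum_{i=1}^{2n+1} g(R(e_i,X)Y,e_i),\qquad \mathrm{Ric}^*(X,Y)=\sum_{i=1}^{2n+1}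 g(R(X,e_i)\varphi e_i,\varphi Y).$$ **Theorem.** Suppose that $g$ is a $*$-Ricci soliton with potential vector field $V$, i.e. $V$ is a smooth vector field and $\lambda$ a real constant with $$(L_Vg)(X,Y)+2\,\mathrm{Ric}^*(X,Y)+2\lambda\,g(X,Y)=0$$ for all smooth vector fields $X,Y$ on $M$. Then: (i) $V$ is a Jacobi field along the geodesics of $\xi$: the integral curves of $\xi$ are geodesics, $\nabla_\xi\xi=0$, and $\nabla_\xi\nabla_\xi V+R(V,\xi)\xi=0$ on $M$. (ii) $M$ is $\eta$-Einstein (its Ricci tensor has the form $\alpha g+\gamma\,\eta\otimes\eta$ with constants $\alpha,\gamma$), and $$\mathrm{Ric}(X,Y)=\Big(2n-1-\frac{\lambda}{2}\Big)g(X,Y)+\Big(1+\frac{\lambda}{2}\Big)\eta(X)\eta(Y)$$ for all $X,Y$. -/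

import Mathlib

open Bundle VectorField FiberBundle
open scoped Manifold ContDiff

namespace SasakianGeometry

noncomputable section

/-! ### The Levi-Civita connection -/

section LeviCivita

variable {E : Type*} [NormedAddCommGroup E] [NormedSpace ℝ E] [FiniteDimensional ℝ E]
  {H : Type*} [TopologicalSpace H] {I : ModelWithCorners ℝ E H}
  {M : Type*} [TopologicalSpace M] [ChartedSpace H M] [IsManifold I ∞ M]
  [RiemannianBundle (fun x : M ↦ TangentSpace I x)]

/-- The right-hand side of the Koszul formula for `2 g(∇_X Y, Z)` at `x`. -/
def koszul (X Y Z : Π x : M, TangentSpace I x) (x : M) : ℝ :=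
  mvfderiv I (fun y ↦ inner ℝ (Y y) (Z y)) x (X x)
    + mvfderiv I (fun y ↦ inner ℝ (X y) (Z y)) x (Y x)
    - mvfderiv I (fun y ↦ inner ℝ (X y) (Y y)) x (Z x)
    + inner ℝ (mlieBracket I X Y x) (Z x)
    - inner ℝ (mlieBracket I X Z x) (Y x)
    - inner ℝ (mlieBracket I Y Z x) (X x)

variable [IsContMDiffRiemannianBundle I ∞ E (fun x : M ↦ TangentSpace I x)]

theorem mdifferentiableAt_inner {Y Z : Π x : M, TangentSpace I x} {x : M}
    (hY : MDiffAt (T% Y) x) (hZ : MDiffAt (T% Z) x) :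
    MDiffAt (fun y ↦ inner ℝ (Y y) (Z y)) x :=
  MDifferentiableAt.inner_bundle (IB := I) (F := E) (E := fun x : M ↦ TangentSpace I x)
    (b := fun x ↦ x) hY hZ

theorem koszul_tensorial_left {Y Z : Π x : M, TangentSpace I x} {x : M}
    (hY : MDiffAt (T% Y) x) (hZ : MDiffAt (T% Z) x) :
    TensorialAt I E (fun X : Π x : M, TangentSpace I x ↦ koszul X Y Z x) x where
  smul {f X} hf hX := by
    have : CompleteSpace E := FiniteDimensional.complete ℝ E
    have h1 := mdifferentiableAt_inner hX hZ
    have h2 := mdifferentiableAt_inner hX hY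
    simp [koszul, inner_smul_left, inner_add_left, mlieBracket_smul_left hf hX,
      mvfderiv_fun_mul hf h1, mvfderiv_fun_mul hf h2, inner_smul_right]
    ring
  add {X X'} hX hX' := by
    have : CompleteSpace E := FiniteDimensional.complete ℝ E
    simp [koszul, inner_add_left, inner_add_right, mlieBracket_add_left hX hX',
      mvfderiv_fun_add (mdifferentiableAt_inner hX hZ) (mdifferentiableAt_inner hX' hZ),
      mvfderiv_fun_add (mdifferentiableAt_inner hX hY) (mdifferentiableAt_inner hX' hY)]
    ring

theorem koszul_tensorial_right {X Y : Π x : M, TangentSpace I x} {x : M}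
    (hX : MDiffAt (T% X) x) (hY : MDiffAt (T% Y) x) :
    TensorialAt I E (fun Z : Π x : M, TangentSpace I x ↦ koszul X Y Z x) x where
  smul {f Z} hf hZ := by
    have : CompleteSpace E := FiniteDimensional.complete ℝ E
    have h1 := mdifferentiableAt_inner hY hZ
    have h2 := mdifferentiableAt_inner hX hZ
    simp [koszul, inner_smul_left, inner_add_left, mlieBracket_smul_right hf hZ,
      mvfderiv_fun_mul hf h1, mvfderiv_fun_mul hf h2, inner_smul_right,
      real_inner_comm (Z x)]
    ring
  add {Z Z'} hZ hZ' := by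
    have : CompleteSpace E := FiniteDimensional.complete ℝ E
    simp [koszul, inner_add_left, inner_add_right, mlieBracket_add_right hZ hZ',
      mvfderiv_fun_add (mdifferentiableAt_inner hY hZ) (mdifferentiableAt_inner hY hZ'),
      mvfderiv_fun_add (mdifferentiableAt_inner hX hZ) (mdifferentiableAt_inner hX hZ')]
    ring

theorem koszul_add_middle {X Y Y' Z : Π x : M, TangentSpace I x} {x : M}
    (hX : MDiffAt (T% X) x) (hY : MDiffAt (T% Y) x) (hY' : MDiffAt (T% Y') x)
    (hZ : MDiffAt (T% Z) x) :
    koszul X (Y + Y') Z x = koszul X Y Z x + koszul X Y' Z x := by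
  have : CompleteSpace E := FiniteDimensional.complete ℝ E
  simp [koszul, inner_add_left, inner_add_right, mlieBracket_add_right hY hY',
    mlieBracket_add_left hY hY',
    mvfderiv_fun_add (mdifferentiableAt_inner hY hZ) (mdifferentiableAt_inner hY' hZ),
    mvfderiv_fun_add (mdifferentiableAt_inner hX hY) (mdifferentiableAt_inner hX hY')]
  ring

theorem koszul_smul_middle {f : M → ℝ} {X Y Z : Π x : M, TangentSpace I x} {x : M}
    (hf : MDiffAt f x) (hX : MDiffAt (T% X) x) (hY : MDiffAt (T% Y) x)
    (hZ : MDiffAt (T% Z) x) :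
    koszul X (f • Y) Z x
      = f x * koszul X Y Z x + 2 * (mvfderiv I f x (X x) * inner ℝ (Y x) (Z x)) := by
  have : CompleteSpace E := FiniteDimensional.complete ℝ E
  simp [koszul, inner_smul_left, inner_add_left, mlieBracket_smul_right hf hY,
    mlieBracket_smul_left hf hY, inner_smul_right,
    mvfderiv_fun_mul hf (mdifferentiableAt_inner hY hZ), mvfderiv_fun_mul hf (mdifferentiableAt_inner hX hY),
    inner_add_right, inner_neg_right, real_inner_comm (X x)]
  ring

instance (x : M) : FiniteDimensional ℝ (TangentSpace I x) :=
  inferInstanceAs (FiniteDimensional ℝ E)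

instance (x : M) : CompleteSpace (TangentSpace I x) :=
  FiniteDimensional.complete ℝ (TangentSpace I x)

/-- For a vector field `Y` differentiable at `x`, the bilinear form `(u, w) ↦ g(∇_u Y, w)` at `x`
given by the Koszul formula. -/
def koszulForm {Y : Π x : M, TangentSpace I x} {x : M} (hY : MDiffAt (T% Y) x) :
    TangentSpace I x →L[ℝ] TangentSpace I x →L[ℝ] ℝ :=
  (2⁻¹ : ℝ) • TensorialAt.mkHom₂ (I := I) (F := E) (F' := E) (fun X Z ↦ koszul X Y Z x) x
    (fun _ hZ ↦ koszul_tensorial_left hY hZ) (fun _ hX ↦ koszul_tensorial_right hX hY)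

open Classical in
/-- The covariant derivative of `Y` at `x`: the endomorphism `u ↦ ∇_u Y` of the tangent space
determined by the Koszul formula (and `0` if `Y` is not differentiable at `x`). -/
def leviCivitaFun (Y : Π x : M, TangentSpace I x) (x : M) :
    TangentSpace I x →L[ℝ] TangentSpace I x :=
  if hY : MDiffAt (T% Y) x then
    LinearMap.toContinuousLinearMap
      { toFun := fun u ↦ (InnerProductSpace.toDual ℝ (TangentSpace I x)).symm (koszulForm hY u)
        map_add' := by simp
        map_smul' := by simp }
  else 0

/-- The Koszul formula. -/
theorem inner_leviCivitaFun {X Y Z : Π x : M, TangentSpace I x} {x : M}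
    (hX : MDiffAt (T% X) x) (hY : MDiffAt (T% Y) x) (hZ : MDiffAt (T% Z) x) :
    inner ℝ (leviCivitaFun Y x (X x)) (Z x) = 2⁻¹ * koszul X Y Z x := by
  have h : inner ℝ (leviCivitaFun Y x (X x)) (Z x) = koszulForm hY (X x) (Z x) := by
    rw [leviCivitaFun, dif_pos hY]
    exact InnerProductSpace.toDual_symm_apply (𝕜 := ℝ) (E := TangentSpace I x)
  rw [h]
  have := TensorialAt.mkHom₂_apply (I := I) (F := E) (F' := E)
    (Φ := fun X Z ↦ koszul X Y Z x)
    (fun _ hZ ↦ koszul_tensorial_left hY hZ) (fun _ hX ↦ koszul_tensorial_right hX hY) hX hZ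
  simp [koszulForm, this]

variable (I M) in
/-- The Levi-Civita connection of the Riemannian metric. -/
def leviCivita : CovariantDerivative I E (TangentSpace I : M → Type _) where
  toFun := leviCivitaFun
  isCovariantDerivativeOnUniv :=
  { add := by
      intro Y Y' x hY hY' _
      ext1 u
      refine ext_inner_right ℝ fun w ↦ ?_
      have hu := mdifferentiableAt_extend I E u
      have hw := mdifferentiableAt_extend I E w
      have hs := mdifferentiableAt_add_section hY hY'
      have e := inner_leviCivitaFun hu hs hw
      have e1 := inner_leviCivitaFun hu hY hw
      have e2 := inner_leviCivitaFun hu hY' hw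
      rw [koszul_add_middle hu hY hY' hw] at e
      simp only [extend_apply_self] at e e1 e2
      rw [add_apply, inner_add_left, e, e1, e2]
      ring
    leibniz := by
      intro Y f x hY hf _
      ext1 u
      refine ext_inner_right ℝ fun w ↦ ?_
      have hu := mdifferentiableAt_extend I E u
      have hw := mdifferentiableAt_extend I E w
      have hs := hf.smul_section hY
      have e := inner_leviCivitaFun hu hs hw
      have e1 := inner_leviCivitaFun hu hY hw
      rw [koszul_smul_middle hf hu hY hw] at e
      simp only [extend_apply_self] at e e1
      rw [e]
      simp [inner_add_left, inner_smul_left, e1]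
      ring }

/-- The Levi-Civita connection is torsion-free. -/
theorem leviCivita_torsion_free {X Y : Π x : M, TangentSpace I x} {x : M}
    (hX : MDiffAt (T% X) x) (hY : MDiffAt (T% Y) x) :
    leviCivita I M Y x (X x) - leviCivita I M X x (Y x) = mlieBracket I X Y x := by
  refine ext_inner_right ℝ fun w ↦ ?_
  have hw := mdifferentiableAt_extend I E w
  have e1 := inner_leviCivitaFun hX hY hw
  have e2 := inner_leviCivitaFun hY hX hw
  simp only [extend_apply_self] at e1 e2
  change inner ℝ (leviCivitaFun Y x (X x) - leviCivitaFun X x (Y x)) w = _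
  rw [inner_sub_left, e1, e2, koszul, koszul, mlieBracket_swap_apply (V := Y) (W := X)]
  simp only [extend_apply_self, inner_neg_left, real_inner_comm (X _)]
  ring

/-- The Levi-Civita connection is compatible with the metric. -/
theorem leviCivita_metric {X Y Z : Π x : M, TangentSpace I x} {x : M}
    (hX : MDiffAt (T% X) x) (hY : MDiffAt (T% Y) x) (hZ : MDiffAt (T% Z) x) :
    mvfderiv I (fun y ↦ inner ℝ (Y y) (Z y)) x (X x)
      = inner ℝ (leviCivita I M Y x (X x)) (Z x) + inner ℝ (Y x) (leviCivita I M Z x (X x)) := by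
  have e1 := inner_leviCivitaFun hX hY hZ
  have e2 := inner_leviCivitaFun hX hZ hY
  change _ = inner ℝ (leviCivitaFun Y x (X x)) (Z x) + inner ℝ (Y x) (leviCivitaFun Z x (X x))
  rw [real_inner_comm (leviCivitaFun Z x (X x)), e1, e2, koszul, koszul,
    mlieBracket_swap_apply (V := Z) (W := Y)]
  simp only [inner_neg_left, real_inner_comm (Y _)]
  ring

end LeviCivita

/-! ### Curvature -/

section Curvature

variable {E : Type*} [NormedAddCommGroup E] [NormedSpace ℝ E] [FiniteDimensional ℝ E]
  {H : Type*} [TopologicalSpace H] {I : ModelWithCorners ℝ E H}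
  {M : Type*} [TopologicalSpace M] [ChartedSpace H M] [IsManifold I ∞ M]
  [RiemannianBundle (fun x : M ↦ TangentSpace I x)]
  [IsContMDiffRiemannianBundle I ∞ E (fun x : M ↦ TangentSpace I x)]

variable (I) in
/-- The covariant derivative `∇_X Y` of vector fields for the Levi-Civita connection. -/
def nabla (X Y : Π x : M, TangentSpace I x) : Π x : M, TangentSpace I x :=
  fun x ↦ leviCivita I M Y x (X x)

variable (I) in
/-- `R(X, Y)Z = ∇_X ∇_Y Z - ∇_Y ∇_X Z - ∇_{[X, Y]} Z` for vector fields. -/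
def curvatureField (X Y Z : Π x : M, TangentSpace I x) : Π x : M, TangentSpace I x :=
  nabla I X (nabla I Y Z) - nabla I Y (nabla I X Z) - nabla I (mlieBracket I X Y) Z

variable (I) in
/-- The Riemann curvature `R(u, v)w` on tangent vectors at `x`, evaluated on extensions of
`u`, `v`, `w` to vector fields that are smooth near `x`. -/
def riemann (x : M) (u v w : TangentSpace I x) : TangentSpace I x :=
  curvatureField I (extend E u) (extend E v) (extend E w) x

variable (I) in
/-- The Ricci tensor `Ric(u, v) = ∑ᵢ g(R(eᵢ, u)v, eᵢ)`, with `(eᵢ)` an orthonormal basis of the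
tangent space at `x`. -/
def ricci (x : M) (u v : TangentSpace I x) : ℝ :=
  ∑ i, inner ℝ (riemann I x (stdOrthonormalBasis ℝ (TangentSpace I x) i) u v)
    (stdOrthonormalBasis ℝ (TangentSpace I x) i)

/-- A smooth vector field. -/
def IsSmoothField (X : Π x : M, TangentSpace I x) : Prop :=
  ContMDiff I (I.prod 𝓘(ℝ, E)) ∞ (fun x ↦ TotalSpace.mk' E x (X x))

/-- The Lie derivative `(L_V g)(X, Y) = V(g(X, Y)) - g([V, X], Y) - g(X, [V, Y])` of the metric. -/
def lieDerivMetric (V X Y : Π x : M, TangentSpace I x) (x : M) : ℝ :=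
  mvfderiv I (fun y ↦ inner ℝ (X y) (Y y)) x (V x)
    - inner ℝ (mlieBracket I V X x) (Y x) - inner ℝ (X x) (mlieBracket I V Y x)

/-- `V` is a Jacobi field along the geodesics of `ξ`: the integral curves of `ξ` are geodesics
and the Jacobi equation `∇_ξ ∇_ξ V + R(V, ξ)ξ = 0` holds. -/
def IsJacobiAlong (ξ V : Π x : M, TangentSpace I x) : Prop :=
  (∀ x, nabla I ξ ξ x = 0) ∧
    ∀ x, nabla I ξ (nabla I ξ V) x + riemann I x (V x) (ξ x) (ξ x) = 0

end Curvature

/-! ### Sasakian structures -/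

section Sasakian

variable {E : Type*} [NormedAddCommGroup E] [NormedSpace ℝ E] [FiniteDimensional ℝ E]
  {H : Type*} [TopologicalSpace H]

/-- An almost contact metric structure `(φ, ξ, η, g)` on a manifold with Riemannian metric `g`. -/
structure AlmostContactMetricStructure (I : ModelWithCorners ℝ E H)
    (M : Type*) [TopologicalSpace M] [ChartedSpace H M] [IsManifold I ∞ M]
    [RiemannianBundle (fun x : M ↦ TangentSpace I x)] where
  /-- the structure tensor -/
  φ : Π x : M, TangentSpace I x →L[ℝ] TangentSpace I x
  /-- the characteristic vector field -/
  ξ : Π x : M, TangentSpace I x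
  /-- the characteristic 1-form -/
  η : Π x : M, TangentSpace I x →L[ℝ] ℝ
  smooth_φ : ContMDiff I (I.prod 𝓘(ℝ, E →L[ℝ] E)) ∞ (fun x ↦ TotalSpace.mk' (E →L[ℝ] E)
    (E := fun x : M ↦ TangentSpace I x →L[ℝ] TangentSpace I x) x (φ x))
  smooth_ξ : IsSmoothField ξ
  smooth_η : ContMDiff I (I.prod 𝓘(ℝ, E →L[ℝ] ℝ)) ∞ (fun x ↦ TotalSpace.mk' (E →L[ℝ] ℝ)
    (E := fun x : M ↦ TangentSpace I x →L[ℝ] Bundle.Trivial M ℝ x) x (η x))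
  φ_φ (x : M) (u : TangentSpace I x) : φ x (φ x u) = -u + η x u • ξ x
  η_ξ (x : M) : η x (ξ x) = 1
  φ_ξ (x : M) : φ x (ξ x) = 0
  η_φ (x : M) (u : TangentSpace I x) : η x (φ x u) = 0
  inner_φ_φ (x : M) (u v : TangentSpace I x) :
    inner ℝ (φ x u) (φ x v) = inner ℝ u v - η x u * η x v

namespace AlmostContactMetricStructure

variable {I : ModelWithCorners ℝ E H}
  {M : Type*} [TopologicalSpace M] [ChartedSpace H M] [IsManifold I ∞ M]
  [RiemannianBundle (fun x : M ↦ TangentSpace I x)]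
  (S : AlmostContactMetricStructure I M)

/-- The exterior derivative of `η`, normalised as
`dη(X, Y) = (X(η(Y)) - Y(η(X)) - η([X, Y])) / 2`. -/
def dη (X Y : Π x : M, TangentSpace I x) (x : M) : ℝ :=
  (mvfderiv I (fun y ↦ S.η y (Y y)) x (X x) - mvfderiv I (fun y ↦ S.η y (X y)) x (Y x)
    - S.η x (mlieBracket I X Y x)) / 2

/-- The Nijenhuis torsion
`[φ, φ](X, Y) = φ²[X, Y] + [φX, φY] - φ[φX, Y] - φ[X, φY]` of `φ`. -/
def nijenhuis (X Y : Π x : M, TangentSpace I x) (x : M) : TangentSpace I x :=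
  S.φ x (S.φ x (mlieBracket I X Y x))
    + mlieBracket I (fun y ↦ S.φ y (X y)) (fun y ↦ S.φ y (Y y)) x
    - S.φ x (mlieBracket I (fun y ↦ S.φ y (X y)) Y x)
    - S.φ x (mlieBracket I X (fun y ↦ S.φ y (Y y)) x)

/-- A Sasakian structure is a contact metric structure, `dη(X, Y) = g(X, φY)`, that is normal,
`[φ, φ] + 2 dη ⊗ ξ = 0`. -/
structure IsSasakian : Prop where
  contact : ∀ X Y : Π x : M, TangentSpace I x, IsSmoothField X → IsSmoothField Y →
    ∀ x, S.dη X Y x = inner ℝ (X x) (S.φ x (Y x))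
  normal : ∀ X Y : Π x : M, TangentSpace I x, IsSmoothField X → IsSmoothField Y →
    ∀ x, S.nijenhuis X Y x + (2 * S.dη X Y x) • S.ξ x = 0

variable [IsContMDiffRiemannianBundle I ∞ E (fun x : M ↦ TangentSpace I x)]

/-- The `*`-Ricci tensor `Ric*(u, v) = ∑ᵢ g(R(u, eᵢ)(φ eᵢ), φ v)`, with `(eᵢ)` an orthonormal basis
of the tangent space at `x`. -/
def starRicci (x : M) (u v : TangentSpace I x) : ℝ :=
  ∑ i, inner ℝ
    (riemann I x u (stdOrthonormalBasis ℝ (TangentSpace I x) i)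
      (S.φ x (stdOrthonormalBasis ℝ (TangentSpace I x) i)))
    (S.φ x v)

/-- The metric is a `*`-Ricci soliton with potential vector field `V` and constant `c`:
`(L_V g)(X, Y) + 2 Ric*(X, Y) + 2 c g(X, Y) = 0` for all smooth vector fields `X`, `Y`. -/
def IsStarRicciSoliton (V : Π x : M, TangentSpace I x) (c : ℝ) : Prop :=
  IsSmoothField V ∧ ∀ X Y : Π x : M, TangentSpace I x, IsSmoothField X → IsSmoothField Y →
    ∀ x, lieDerivMetric V X Y x + 2 * S.starRicci x (X x) (Y x)
      + 2 * c * inner ℝ (X x) (Y x) = 0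

/-- `Ric = α g + γ η ⊗ η`. -/
def IsEtaEinsteinWith (α γ : ℝ) : Prop :=
  ∀ (x : M) (u v : TangentSpace I x),
    ricci I x u v = α * inner ℝ u v + γ * (S.η x u * S.η x v)

/-- `M` is `η`-Einstein: `Ric = α g + γ η ⊗ η` for some constants `α`, `γ`. -/
def IsEtaEinstein : Prop := ∃ α γ : ℝ, S.IsEtaEinsteinWith α γ

end AlmostContactMetricStructure

end Sasakian

end

end SasakianGeometry

/-!
On a Sasakian manifold `∇_X ξ = -φX` and `(∇_X φ)Y = g(X, Y)ξ - η(Y)X`, the field `ξ` is Killing,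
`R(X, Y)ξ = η(Y)X - η(X)Y`, and the `*`-Ricci tensor is `Ric* = Ric - (2n - 1)g - η ⊗ η`, which is
invariant under `φ` and under the flow of `ξ`. It is therefore enough to determine `Ric*`.

Let `L_V g = -2 Ric* - 2λg` and put `A = [V, ξ]`. The right-hand side is preserved by the Killing
field `ξ`, so `L_A g = L_V L_ξ g - L_ξ L_V g = 0` and `A` is again Killing
(`isKilling_brk_potential`). Evaluating the soliton equation on `(ξ, ξ)` gives `η(A) = λ`, whence
`∇_ξ A = φA` and `[ξ, A] = 2φA`. A bracket of Killing fields is Killing, so `φA` is Killing too, and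
by the formula for `∇φ` this determines `φ∇A + (φ∇A)ᵀ` (`inn_ph_nab_brk`).

The Lie derivative of `φ` follows from `L_V dη = d(L_V η)`: it is `g(X, (L_V φ)Y) =
g(∇_X A, Y) + 2 Ric*(X, φY)` (`inn_lie_ph`). Inserting it into the Lie derivative of
`g(φX, φY) = g(X, Y) - η(X)η(Y)` leaves an algebraic identity whose solution is
`2 Ric* = -λ(g - η ⊗ η)` (`two_mul_R`); this is the formula for `Ric`. The Jacobi equation comes from
differentiating `∇_ξ V = -φV - A` once more along `ξ` (`nab_xi_nab_xi`).

The computations take place in the module `VField I M` of smooth vector fields over the ring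
`SFun I M` of smooth functions. Three facts connect it with tensors at a point: every tangent vector
is the value of a smooth field, smooth local orthonormal frames exist, and the value of `R(X, Y)Z`
at a point depends only on the values of `X`, `Y`, `Z` there (`Rm_congr`).
-/

namespace SasakianGeometry

noncomputable section

open Topology InnerProductSpace

set_option linter.unusedSectionVars false

section Fields

variable {E : Type*} [NormedAddCommGroup E] [NormedSpace ℝ E] [FiniteDimensional ℝ E]
  {H : Type*} [TopologicalSpace H] {I : ModelWithCorners ℝ E H}
  {M : Type*} [TopologicalSpace M] [ChartedSpace H M] [IsManifold I ∞ M]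

variable (I M) in
/-- Smooth vector fields, as bundled sections of the tangent bundle. -/
abbrev VField : Type _ := Cₛ^∞⟮I; E, (TangentSpace I : M → Type _)⟯

variable (I M) in
/-- Smooth real functions. -/
abbrev SFun : Type _ := C^∞⟮I, M; ℝ⟯

/-! ### Smooth vector fields as a module over smooth functions -/

instance : SMul (SFun I M) (VField I M) :=
  ⟨fun f X ↦ ⟨fun x ↦ f x • X x, f.contMDiff.smul_section X.contMDiff⟩⟩

@[simp]
theorem funSMul_apply (f : SFun I M) (X : VField I M) (x : M) : (f • X) x = f x • X x := rfl

instance : Module (SFun I M) (VField I M) where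
  one_smul X := by ext x; simp
  mul_smul f g X := by ext x; simp [mul_smul]
  smul_zero f := by ext x; simp
  smul_add f X Y := by ext x; simp
  add_smul f g X := by ext x; simp [add_smul]
  zero_smul X := by ext x; simp

theorem VField.mdiffAt (X : VField I M) (x : M) : MDiffAt (T% (fun y ↦ X y)) x :=
  X.mdifferentiableAt

theorem SFun.mdiffAt (f : SFun I M) (x : M) : MDiffAt (fun y ↦ f y) x :=
  f.mdifferentiableAt

theorem contMDiff_mvfderiv_apply (X : VField I M) (f : SFun I M) :
    ContMDiff I 𝓘(ℝ, ℝ) ∞ (fun x ↦ mvfderiv I (fun y ↦ f y) x (X x)) := by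
  have h1 : ContMDiff I.tangent 𝓘(ℝ, ℝ).tangent ∞ (tangentMap I 𝓘(ℝ, ℝ) (fun y ↦ f y)) :=
    f.contMDiff.contMDiff_tangentMap (m := ∞) (by simp)
  exact (contMDiff_snd_tangentBundle_modelSpace ℝ 𝓘(ℝ, ℝ)).comp (h1.comp X.contMDiff)

/-- The derivative `X f` of a function along a vector field. -/
def der (X : VField I M) (f : SFun I M) : SFun I M :=
  ⟨fun x ↦ mvfderiv I (fun y ↦ f y) x (X x), contMDiff_mvfderiv_apply X f⟩

theorem der_apply (X : VField I M) (f : SFun I M) (x : M) :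
    der X f x = mvfderiv I (fun y ↦ f y) x (X x) := rfl

theorem isManifold_minSmoothness {m : ℕ∞ω} (hm : m ≤ ∞) : IsManifold I (minSmoothness ℝ m) M := by
  rw [minSmoothness_of_isRCLikeNormedField]
  exact IsManifold.of_le hm

theorem contMDiff_mlieBracket (X Y : VField I M) :
    ContMDiff I (I.prod 𝓘(ℝ, E)) ∞
      (fun x ↦ TotalSpace.mk' E x (mlieBracket I (fun y ↦ X y) (fun y ↦ Y y) x)) := by
  have : CompleteSpace E := FiniteDimensional.complete ℝ E
  have : IsManifold I (minSmoothness ℝ 2) M := isManifold_minSmoothness ENat.LEInfty.out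
  have : IsManifold I (((⊤ : ℕ∞) : ℕ∞ω) + 1) M := by
    change IsManifold I ∞ M; infer_instance
  intro x
  exact ContMDiffAt.mlieBracket_vectorField (n := ⊤) (m := ⊤) X.contMDiff.contMDiffAt
    Y.contMDiff.contMDiffAt (by simp)

/-- The Lie bracket of smooth vector fields. -/
def brk (X Y : VField I M) : VField I M :=
  ⟨mlieBracket I (fun y ↦ X y) (fun y ↦ Y y), contMDiff_mlieBracket X Y⟩

theorem brk_apply (X Y : VField I M) (x : M) :
    brk X Y x = mlieBracket I (fun y ↦ X y) (fun y ↦ Y y) x := rfl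

/-! ### Derivations and the Lie bracket -/

@[simp]
theorem der_add (X : VField I M) (f g : SFun I M) : der X (f + g) = der X f + der X g := by
  ext x
  have := mvfderiv_fun_add (I := I) (f.mdiffAt x) (g.mdiffAt x)
  simp [der_apply, this]

@[simp]
theorem der_mul (X : VField I M) (f g : SFun I M) :
    der X (f * g) = f * der X g + g * der X f := by
  ext x
  have := mvfderiv_fun_mul (I := I) (f.mdiffAt x) (g.mdiffAt x)
  simp [der_apply, this]

@[simp]
theorem der_algebraMap (X : VField I M) (c : ℝ) : der X (algebraMap ℝ (SFun I M) c) = 0 := by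
  ext x
  have : (fun y : M ↦ (algebraMap ℝ (SFun I M) c) y) = fun _ ↦ c := rfl
  rw [der_apply, this, mvfderiv_const]
  rfl

@[simp]
theorem der_smul (X : VField I M) (c : ℝ) (f : SFun I M) : der X (c • f) = c • der X f := by
  rw [Algebra.smul_def, der_mul, der_algebraMap, Algebra.smul_def]; ring

@[simp]
theorem der_neg (X : VField I M) (f : SFun I M) : der X (-f) = -der X f := by
  have := der_smul X (-1) f
  simpa using this

@[simp]
theorem der_sub (X : VField I M) (f g : SFun I M) : der X (f - g) = der X f - der X g := by
  simp [sub_eq_add_neg]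

@[simp]
theorem der_zero (X : VField I M) : der X (0 : SFun I M) = 0 := by
  simpa using der_smul X 0 (0 : SFun I M)

@[simp]
theorem der_one (X : VField I M) : der X (1 : SFun I M) = 0 := by
  simpa using der_algebraMap X 1

@[simp]
theorem der_sum {ι : Type*} (s : Finset ι) (X : VField I M) (f : ι → SFun I M) :
    der X (∑ i ∈ s, f i) = ∑ i ∈ s, der X (f i) :=
  map_sum (AddMonoidHom.mk' (der X) (der_add X)) f s

/-- The derivative at a point depends only on the germ of the function there. -/
theorem der_congr (X : VField I M) {f g : SFun I M} {x : M} (h : (f : M → ℝ) =ᶠ[𝓝 x] g) :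
    der X f x = der X g x := by
  simp only [der_apply, mvfderiv]
  have : (fun y ↦ f y) =ᶠ[𝓝 x] fun y ↦ g y := h
  rw [this.mfderiv_eq, show f x = g x from this.eq_of_nhds]
  rfl

theorem brk_swap (X Y : VField I M) : brk Y X = -brk X Y := by
  ext x
  simp [brk_apply, mlieBracket_swap_apply (V := fun y ↦ Y y)]

@[simp]
theorem brk_self (X : VField I M) : brk X X = 0 := by
  ext x; simp [brk_apply]

@[simp]
theorem brk_add_right (X Y Z : VField I M) : brk X (Y + Z) = brk X Y + brk X Z := by
  have : CompleteSpace E := FiniteDimensional.complete ℝ E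
  ext x
  exact mlieBracket_add_right (Y.mdiffAt x) (Z.mdiffAt x)

@[simp]
theorem brk_funSMul_right (f : SFun I M) (X Y : VField I M) :
    brk X (f • Y) = der X f • Y + f • brk X Y := by
  have : CompleteSpace E := FiniteDimensional.complete ℝ E
  ext x
  have := mlieBracket_smul_right (V := fun y ↦ X y) (f.mdiffAt x) (Y.mdiffAt x)
  exact this

@[simp]
theorem brk_neg_right (X Y : VField I M) : brk X (-Y) = -brk X Y :=
  map_neg (AddMonoidHom.mk' (brk X) (brk_add_right X)) Y

@[simp]
theorem brk_sub_right (X Y Z : VField I M) : brk X (Y - Z) = brk X Y - brk X Z := by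
  simp [sub_eq_add_neg]

@[simp]
theorem brk_zero_right (X : VField I M) : brk X 0 = 0 :=
  map_zero (AddMonoidHom.mk' (brk X) (brk_add_right X))

theorem jacobi (X Y Z : VField I M) : brk X (brk Y Z) = brk (brk X Y) Z + brk Y (brk X Z) := by
  have : CompleteSpace E := FiniteDimensional.complete ℝ E
  have : IsManifold I (minSmoothness ℝ 3) M := isManifold_minSmoothness ENat.LEInfty.out
  have h2 : minSmoothness ℝ 2 ≤ (∞ : ℕ∞ω) := by
    simpa using ENat.LEInfty.out
  ext x
  exact leibniz_identity_mlieBracket_apply ((X.contMDiff x).of_le h2) ((Y.contMDiff x).of_le h2)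
    ((Z.contMDiff x).of_le h2)

/-! ### Germs of vector fields -/

variable [T2Space M]

/-- Every germ of a smooth vector field is the germ of a global one: multiply by a bump function. -/
theorem exists_field_eventuallyEq {σ : Π x : M, TangentSpace I x} {s : Set M} {x : M}
    (hs : s ∈ 𝓝 x) (hσ : ContMDiffOn I (I.prod 𝓘(ℝ, E)) ∞ (T% σ) s) :
    ∃ X : VField I M, ∀ᶠ y in 𝓝 x, X y = σ y := by
  obtain ⟨f, -, hf⟩ := (SmoothBumpFunction.nhds_basis_tsupport (I := I) x).mem_iff.1
    (interior_mem_nhds.2 hs)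
  refine ⟨⟨fun y ↦ f y • σ y, ContMDiffOn.smul_section_of_tsupport (ψ := f)
    f.contMDiff.contMDiffOn isOpen_interior hf (hσ.mono interior_subset)⟩, ?_⟩
  filter_upwards [f.eventuallyEq_one] with y hy
  simp [hy]

theorem exists_field_extend {x : M} (u : TangentSpace I x) :
    ∃ X : VField I M, ∀ᶠ y in 𝓝 x, X y = extend E u y := by
  obtain ⟨s, hs, h⟩ := exists_contMDiffOn_extend (k := ∞) I E u
  exact exists_field_eventuallyEq hs h

theorem exists_field_apply {x : M} (u : TangentSpace I x) : ∃ X : VField I M, X x = u := by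
  obtain ⟨X, hX⟩ := exists_field_extend u
  exact ⟨X, by simpa using hX.self_of_nhds⟩

/-- The Lie bracket acts on functions as the commutator of derivations. The identity is read off
from the Jacobi identity for `X`, `Y` and `f Z`, where `Z` does not vanish at the given point. -/
theorem der_brk (X Y : VField I M) (f : SFun I M) :
    der (brk X Y) f = der X (der Y f) - der Y (der X f) := by
  ext x
  -- If the tangent space is trivial there is no such `Z`, but then all fields vanish at `x`.
  rcases subsingleton_or_nontrivial (TangentSpace I x) with h | h
  · simp [der_apply, Subsingleton.elim (brk X Y x) 0, Subsingleton.elim (X x) 0,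
      Subsingleton.elim (Y x) 0]
  · obtain ⟨u, hu⟩ := exists_ne (0 : TangentSpace I x)
    obtain ⟨Z, rfl⟩ := exists_field_apply u
    have h1 := jacobi X Y (f • Z)
    simp only [brk_funSMul_right, brk_add_right, jacobi X Y Z] at h1
    have h2 : (der (brk X Y) f - (der X (der Y f) - der Y (der X f))) • Z = 0 := by
      rw [← sub_eq_zero] at h1
      rw [← neg_eq_zero, ← h1]
      module
    have h3 := congrArg (fun W : VField I M ↦ W x) h2
    simpa [hu, sub_eq_zero] using h3

end Fields

section Frames

variable {E : Type*} [NormedAddCommGroup E] [NormedSpace ℝ E] [FiniteDimensional ℝ E]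
  {H : Type*} [TopologicalSpace H] {I : ModelWithCorners ℝ E H}
  {M : Type*} [TopologicalSpace M] [ChartedSpace H M] [IsManifold I ∞ M]
  [RiemannianBundle (fun x : M ↦ TangentSpace I x)]
  [IsContMDiffRiemannianBundle I ∞ E (fun x : M ↦ TangentSpace I x)]

/-! ### Local orthonormal frames -/

theorem contMDiffOn_inner {X Y : Π x : M, TangentSpace I x} {s : Set M}
    (hX : ContMDiffOn I (I.prod 𝓘(ℝ, E)) ∞ (T% X) s)
    (hY : ContMDiffOn I (I.prod 𝓘(ℝ, E)) ∞ (T% Y) s) :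
    ContMDiffOn I 𝓘(ℝ, ℝ) ∞ (fun y ↦ inner ℝ (X y) (Y y)) s :=
  ContMDiffOn.inner_bundle (IB := I) (F := E) (E := fun x : M ↦ TangentSpace I x)
    (b := fun x ↦ x) hX hY

/-- The Gram–Schmidt process preserves smoothness of pointwise independent vector fields. -/
theorem contMDiffOn_gramSchmidt {m : ℕ} {X : Fin m → Π x : M, TangentSpace I x} {s : Set M}
    (hX : ∀ i, ContMDiffOn I (I.prod 𝓘(ℝ, E)) ∞ (T% (X i)) s)
    (hli : ∀ x ∈ s, LinearIndependent ℝ fun i ↦ X i x) (i : Fin m) :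
    ContMDiffOn I (I.prod 𝓘(ℝ, E)) ∞
      (T% (fun x ↦ gramSchmidt ℝ (fun j ↦ X j x) i)) s := by
  induction i using WellFoundedLT.induction with
  | ind i ih =>
    have h : ∀ x, gramSchmidt ℝ (fun j ↦ X j x) i = X i x -
        ∑ j ∈ Finset.Iio i, (inner ℝ (gramSchmidt ℝ (fun j ↦ X j x) j) (X i x)
          / ‖gramSchmidt ℝ (fun j ↦ X j x) j‖ ^ 2) • gramSchmidt ℝ (fun j ↦ X j x) j := by
      intro x
      rw [eq_sub_iff_add_eq]
      exact (gramSchmidt_def'' ℝ (fun j ↦ X j x) i).symm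
    simp only [h]
    refine ContMDiffOn.sub_section (hX i) (ContMDiffOn.sum_section fun j hj ↦ ?_)
    have hj' := ih j (Finset.mem_Iio.1 hj)
    refine ContMDiffOn.smul_section (s := fun x ↦ gramSchmidt ℝ (fun j ↦ X j x) j) ?_ hj'
    refine ContMDiffOn.div₀ (contMDiffOn_inner hj' (hX i)) ?_ ?_
    · simp only [← real_inner_self_eq_norm_sq]
      exact contMDiffOn_inner hj' hj'
    · intro x hx
      have := gramSchmidt_ne_zero j (hli x hx)
      simpa using this

variable [T2Space M]

/-- Near every point there is a smooth orthonormal frame, obtained by the Gram–Schmidt process from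
the frame of a trivialization and extended to global fields. -/
theorem exists_orthonormal_frame (x : M) :
    ∃ e : Fin (Module.finrank ℝ E) → VField I M,
      ∀ᶠ y in 𝓝 x, Orthonormal ℝ (fun i ↦ e i y) := by
  set t := trivializationAt E (TangentSpace I : M → Type _) x
  set b := Module.finBasis ℝ E
  have hx : x ∈ t.baseSet := FiberBundle.mem_baseSet_trivializationAt' x
  have hX (i) : ContMDiffOn I (I.prod 𝓘(ℝ, E)) ∞ (T% (t.localFrame b i)) t.baseSet :=
    t.contMDiffOn_localFrame_baseSet (I := I) ∞ b i
  have hli : ∀ y ∈ t.baseSet, LinearIndependent ℝ fun i ↦ t.localFrame b i y := fun y hy ↦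
    (t.isLocalFrameOn_localFrame_baseSet I ∞ b).linearIndependent hy
  have hg := contMDiffOn_gramSchmidt hX hli
  have hn (i) : ContMDiffOn I (I.prod 𝓘(ℝ, E)) ∞
      (T% (fun y ↦ gramSchmidtNormed ℝ (fun j ↦ t.localFrame b j y) i)) t.baseSet := by
    refine ContMDiffOn.smul_section
      (s := fun y ↦ gramSchmidt ℝ (fun j ↦ t.localFrame b j y) i) ?_ (hg i)
    refine ContMDiffOn.inv₀ ?_ ?_
    · have h1 := contMDiffOn_inner (hg i) (hg i)
      have h2 : ∀ y ∈ t.baseSet,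
          inner ℝ (gramSchmidt ℝ (fun j ↦ t.localFrame b j y) i)
            (gramSchmidt ℝ (fun j ↦ t.localFrame b j y) i) ≠ 0 := fun y hy ↦ by
        simpa using gramSchmidt_ne_zero i (hli y hy)
      intro y hy
      have h3 := (Real.contDiffAt_sqrt (n := ∞) (h2 y hy)).contMDiffAt.comp_contMDiffWithinAt y
        (h1 y hy)
      exact h3.congr (fun z _ ↦ norm_eq_sqrt_real_inner (F := TangentSpace I z) _)
        (norm_eq_sqrt_real_inner (F := TangentSpace I y) _)
    · intro y hy
      simpa using gramSchmidt_ne_zero i (hli y hy)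
  have hmem := t.open_baseSet.mem_nhds hx
  choose e he using fun i ↦ exists_field_eventuallyEq hmem (hn i)
  refine ⟨e, ?_⟩
  filter_upwards [Filter.eventually_all.2 he, hmem] with y hy hy'
  simp only [hy]
  exact gramSchmidtNormed_orthonormal (hli y hy')

/-- The orthonormal basis formed by the values at `x` of orthonormal fields. -/
def frameBasis {x : M} {e : Fin (Module.finrank ℝ E) → VField I M}
    (h : Orthonormal ℝ (fun i ↦ e i x)) :
    OrthonormalBasis (Fin (Module.finrank ℝ E)) ℝ (TangentSpace I x) :=
  OrthonormalBasis.mk h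
    (h.linearIndependent.span_eq_top_of_card_eq_finrank' (by simp; rfl)).ge

@[simp]
theorem frameBasis_apply {x : M} {e : Fin (Module.finrank ℝ E) → VField I M}
    (h : Orthonormal ℝ (fun i ↦ e i x)) (i) : frameBasis h i = e i x := by
  simp [frameBasis]

/-- A vector field is smooth as soon as its inner products with smooth fields are smooth. -/
theorem contMDiff_of_inner {Y : Π x : M, TangentSpace I x}
    (h : ∀ Z : VField I M, ContMDiff I 𝓘(ℝ, ℝ) ∞ (fun x ↦ inner ℝ (Z x) (Y x))) :
    ContMDiff I (I.prod 𝓘(ℝ, E)) ∞ (T% Y) := by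
  intro x
  obtain ⟨e, he⟩ := exists_orthonormal_frame (I := I) x
  have h1 : ContMDiff I (I.prod 𝓘(ℝ, E)) ∞
      (T% (fun y ↦ ∑ i, inner ℝ (e i y) (Y y) • e i y)) :=
    ContMDiff.sum_section fun i _ ↦
      ContMDiff.smul_section (s := fun y ↦ e i y) (h (e i)) (e i).contMDiff
  refine (h1 x).congr_of_eventuallyEq ?_
  filter_upwards [he] with y hy
  have := (frameBasis hy).sum_repr' (Y y)
  simp only [frameBasis_apply] at this
  simp [this]

end Frames

section Riemannian

variable {E : Type*} [NormedAddCommGroup E] [NormedSpace ℝ E] [FiniteDimensional ℝ E]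
  {H : Type*} [TopologicalSpace H] {I : ModelWithCorners ℝ E H}
  {M : Type*} [TopologicalSpace M] [ChartedSpace H M] [IsManifold I ∞ M]
  [RiemannianBundle (fun x : M ↦ TangentSpace I x)]
  [IsContMDiffRiemannianBundle I ∞ E (fun x : M ↦ TangentSpace I x)] [T2Space M]

/-! ### The metric and the Levi-Civita connection on smooth fields -/

/-- The function `g(X, Y)`. -/
def inn (X Y : VField I M) : SFun I M :=
  ⟨fun x ↦ inner ℝ (X x) (Y x), ContMDiff.inner_bundle (IB := I) (F := E)
    (E := fun x : M ↦ TangentSpace I x) (b := fun x ↦ x) X.contMDiff Y.contMDiff⟩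

theorem inn_apply (X Y : VField I M) (x : M) : inn X Y x = inner ℝ (X x) (Y x) := rfl

theorem inn_comm (X Y : VField I M) : inn X Y = inn Y X := by
  ext x; exact real_inner_comm (F := TangentSpace I x) _ _

@[simp]
theorem inn_add_left (X Y Z : VField I M) : inn (X + Y) Z = inn X Z + inn Y Z := by
  ext x; simp [inn_apply, inner_add_left]

@[simp]
theorem inn_funSMul_left (f : SFun I M) (X Y : VField I M) : inn (f • X) Y = f * inn X Y := by
  ext x; simp [inn_apply, inner_smul_left]

@[simp]
theorem inn_add_right (X Y Z : VField I M) : inn X (Y + Z) = inn X Y + inn X Z := by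
  rw [inn_comm, inn_add_left, inn_comm Y, inn_comm Z]

@[simp]
theorem inn_funSMul_right (f : SFun I M) (X Y : VField I M) : inn X (f • Y) = f * inn X Y := by
  rw [inn_comm, inn_funSMul_left, inn_comm Y]

@[simp]
theorem inn_neg_left (X Y : VField I M) : inn (-X) Y = -inn X Y := by
  simpa using inn_funSMul_left (-1) X Y

@[simp]
theorem inn_neg_right (X Y : VField I M) : inn X (-Y) = -inn X Y := by
  simpa using inn_funSMul_right (-1) X Y

@[simp]
theorem inn_sub_left (X Y Z : VField I M) : inn (X - Y) Z = inn X Z - inn Y Z := by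
  simp [sub_eq_add_neg]

@[simp]
theorem inn_sub_right (X Y Z : VField I M) : inn X (Y - Z) = inn X Y - inn X Z := by
  simp [sub_eq_add_neg]

@[simp]
theorem inn_zero_left (Y : VField I M) : inn 0 Y = 0 := by
  simpa using inn_funSMul_left 0 0 Y

@[simp]
theorem inn_zero_right (Y : VField I M) : inn Y 0 = 0 := by
  simpa using inn_funSMul_right 0 Y 0

theorem ext_inn {X Y : VField I M} (h : ∀ Z, inn X Z = inn Y Z) : X = Y := by
  ext x
  refine ext_inner_right ℝ fun w ↦ ?_
  obtain ⟨Z, rfl⟩ := exists_field_apply w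
  exact congrArg (fun f : SFun I M ↦ f x) (h Z)

/-- The Koszul formula expresses `g(∇_X Y, Z)` by smooth functions, so `∇_X Y` is smooth. -/
theorem contMDiff_nabla (X Y : VField I M) :
    ContMDiff I (I.prod 𝓘(ℝ, E)) ∞
      (fun x ↦ TotalSpace.mk' E x (nabla I (fun y ↦ X y) (fun y ↦ Y y) x)) := by
  refine contMDiff_of_inner fun Z ↦ ?_
  have h (x : M) : inner ℝ (Z x) (nabla I (fun y ↦ X y) (fun y ↦ Y y) x) =
      ((2⁻¹ : ℝ) • (der X (inn Y Z) + der Y (inn X Z) - der Z (inn X Y)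
        + inn (brk X Y) Z - inn (brk X Z) Y - inn (brk Y Z) X)) x := by
    rw [real_inner_comm]
    exact inner_leviCivitaFun (X.mdiffAt x) (Y.mdiffAt x) (Z.mdiffAt x)
  simp only [h]
  exact ContMDiffMap.contMDiff _

/-- The covariant derivative `∇_X Y` of smooth fields. -/
def nab (X Y : VField I M) : VField I M :=
  ⟨nabla I (fun y ↦ X y) (fun y ↦ Y y), contMDiff_nabla X Y⟩

theorem nab_apply (X Y : VField I M) (x : M) :
    nab X Y x = leviCivita I M (fun y ↦ Y y) x (X x) := rfl

theorem torsion_free (X Y : VField I M) : nab X Y - nab Y X = brk X Y := by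
  ext x
  exact leviCivita_torsion_free (X.mdiffAt x) (Y.mdiffAt x)

theorem der_inn (X Y Z : VField I M) :
    der X (inn Y Z) = inn (nab X Y) Z + inn Y (nab X Z) := by
  ext x
  exact leviCivita_metric (X.mdiffAt x) (Y.mdiffAt x) (Z.mdiffAt x)

@[simp]
theorem nab_add_left (X Y Z : VField I M) : nab (X + Y) Z = nab X Z + nab Y Z := by
  ext x; simp [nab_apply]

@[simp]
theorem nab_funSMul_left (f : SFun I M) (X Y : VField I M) : nab (f • X) Y = f • nab X Y := by
  ext x; simp [nab_apply]

@[simp]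
theorem nab_neg_left (X Y : VField I M) : nab (-X) Y = -nab X Y := by
  ext x; simp [nab_apply]

@[simp]
theorem nab_sub_left (X Y Z : VField I M) : nab (X - Y) Z = nab X Z - nab Y Z := by
  simp [sub_eq_add_neg]

@[simp]
theorem nab_add_right (X Y Z : VField I M) : nab X (Y + Z) = nab X Y + nab X Z := by
  refine ext_inn fun W ↦ ?_
  have h := der_inn X (Y + Z) W
  rw [inn_add_left, der_add, der_inn, der_inn, inn_add_left] at h
  rw [inn_add_left]
  linear_combination -h

@[simp]
theorem nab_funSMul_right (f : SFun I M) (X Y : VField I M) :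
    nab X (f • Y) = der X f • Y + f • nab X Y := by
  refine ext_inn fun W ↦ ?_
  have h := der_inn X (f • Y) W
  rw [inn_funSMul_left, der_mul, der_inn, inn_funSMul_left] at h
  simp only [inn_add_left, inn_funSMul_left]
  linear_combination -h

@[simp]
theorem nab_neg_right (X Y : VField I M) : nab X (-Y) = -nab X Y :=
  map_neg (AddMonoidHom.mk' (nab X) (nab_add_right X)) Y

@[simp]
theorem nab_sub_right (X Y Z : VField I M) : nab X (Y - Z) = nab X Y - nab X Z := by
  simp [sub_eq_add_neg]

/-! ### Symmetries of the curvature -/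

/-- The curvature `R(X, Y)Z` of smooth fields. -/
def Rm (X Y Z : VField I M) : VField I M :=
  nab X (nab Y Z) - nab Y (nab X Z) - nab (brk X Y) Z

theorem Rm_swap (X Y Z : VField I M) : Rm Y X Z = -Rm X Y Z := by
  simp only [Rm, brk_swap X Y, nab_neg_left]
  abel

theorem inn_Rm_swap (X Y Z W : VField I M) : inn (Rm X Y Z) W = -inn (Rm X Y W) Z := by
  have h3 := der_brk X Y (inn Z W)
  simp only [der_add, der_inn] at h3
  rw [inn_comm (Rm X Y W)]
  simp only [Rm, inn_sub_left, inn_sub_right]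
  linear_combination -h3

theorem bianchi (X Y Z : VField I M) : Rm X Y Z + Rm Y Z X + Rm Z X Y = 0 := by
  have h := jacobi X Y Z
  have e : brk (brk X Y) Z = -brk Z (brk X Y) := brk_swap _ _
  have e' : brk Y (brk X Z) = -brk Y (brk Z X) := by rw [brk_swap Z X]; simp
  rw [e, e'] at h
  simp only [← torsion_free, nab_sub_right, nab_sub_left] at h
  simp only [Rm, ← torsion_free, nab_sub_left]
  rw [← sub_eq_zero] at h
  rw [← h]
  abel

/-- Pair symmetry, the alternating sum of four instances of the first Bianchi identity. -/
theorem inn_Rm_pair (X Y Z W : VField I M) : inn (Rm X Y Z) W = inn (Rm Z W X) Y := by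
  have b (X Y Z W : VField I M) : inn (Rm X Y Z) W + inn (Rm Y Z X) W + inn (Rm Z X Y) W = 0 := by
    rw [← inn_add_left, ← inn_add_left, bianchi, inn_zero_left]
  have s (X Y Z W : VField I M) : inn (Rm X Y Z) W = -inn (Rm Y X Z) W := by
    rw [Rm_swap]; simp
  have k := inn_Rm_swap (I := I) (M := M)
  have h1 := b X Y Z W
  have h2 := b Y Z W X
  have h3 := b Z W X Y
  have h4 := b W X Y Z
  rw [s Z X Y W] at h1
  rw [k Y Z W X, k Z W Y X, s W Y Z X, k Y W Z X] at h2
  rw [s W X Z Y, k X W Z Y, k X Z W Y] at h3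
  rw [s W X Y Z, k X Y W Z] at h4
  have h : (2 : ℝ) • (inn (Rm X Y Z) W - inn (Rm Z W X) Y) = 0 := by
    rw [two_smul]
    linear_combination h1 - h4 + h2 - h3
  have := (smul_eq_zero.1 h).resolve_left two_ne_zero
  exact sub_eq_zero.1 this

end Riemannian

section Pointwise

variable {E : Type*} [NormedAddCommGroup E] [NormedSpace ℝ E] [FiniteDimensional ℝ E]
  {H : Type*} [TopologicalSpace H] {I : ModelWithCorners ℝ E H}
  {M : Type*} [TopologicalSpace M] [ChartedSpace H M] [IsManifold I ∞ M]
  [RiemannianBundle (fun x : M ↦ TangentSpace I x)]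
  [IsContMDiffRiemannianBundle I ∞ E (fun x : M ↦ TangentSpace I x)] [T2Space M]

/-! ### Curvature at a point -/

/-- The covariant derivative is local: bundled fields compute it for arbitrary fields with the same
germs. -/
theorem nabla_eventuallyEq {σ τ : Π x : M, TangentSpace I x} {X Y : VField I M} {x : M}
    (hX : ∀ᶠ y in 𝓝 x, X y = σ y) (hY : ∀ᶠ y in 𝓝 x, Y y = τ y) :
    ∀ᶠ y in 𝓝 x, nab X Y y = nabla I σ τ y := by
  filter_upwards [hX, hY.eventually_nhds] with y hy hy'
  have hτ : MDiffAt (T% τ) y := (Y.mdiffAt y).congr_of_eventuallyEq (by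
    filter_upwards [hy'] with z hz
    rw [hz])
  rw [nab_apply, nabla, hy, (leviCivita I M).isCovariantDerivativeOnUniv.congr_of_eventuallyEq
    (Y.mdiffAt y) hτ Filter.univ_mem hy']

theorem brk_eventuallyEq {σ τ : Π x : M, TangentSpace I x} {X Y : VField I M} {x : M}
    (hX : ∀ᶠ y in 𝓝 x, X y = σ y) (hY : ∀ᶠ y in 𝓝 x, Y y = τ y) :
    ∀ᶠ y in 𝓝 x, brk X Y y = mlieBracket I σ τ y :=
  Filter.EventuallyEq.mlieBracket_vectorField (V₁ := fun y ↦ X y) (W₁ := fun y ↦ Y y) hX hY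

theorem curvatureField_eventuallyEq {σ τ υ : Π x : M, TangentSpace I x} {X Y Z : VField I M}
    {x : M} (hX : ∀ᶠ y in 𝓝 x, X y = σ y) (hY : ∀ᶠ y in 𝓝 x, Y y = τ y)
    (hZ : ∀ᶠ y in 𝓝 x, Z y = υ y) : Rm X Y Z x = curvatureField I σ τ υ x := by
  have h1 := nabla_eventuallyEq hX (nabla_eventuallyEq hY hZ)
  have h2 := nabla_eventuallyEq hY (nabla_eventuallyEq hX hZ)
  have h3 := nabla_eventuallyEq (brk_eventuallyEq hX hY) hZ
  simp [Rm, curvatureField, h1.self_of_nhds, h2.self_of_nhds, h3.self_of_nhds]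

/-- The curvature at a point depends only on the values of the fields at that point: the last slot
of `g(R(X, Y)Z, W)` is tensorial by definition and the symmetries carry this to the others. -/
theorem Rm_congr {X Y Z X' Y' Z' : VField I M} {x : M} (hX : X x = X' x) (hY : Y x = Y' x)
    (hZ : Z x = Z' x) : Rm X Y Z x = Rm X' Y' Z' x := by
  have last (X Y Z W W' : VField I M) (h : W x = W' x) :
      inn (Rm X Y Z) W x = inn (Rm X Y Z) W' x := by simp only [inn_apply, h]
  have third (X Y Z Z' W : VField I M) (h : Z x = Z' x) :
      inn (Rm X Y Z) W x = inn (Rm X Y Z') W x := by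
    rw [inn_Rm_swap, inn_Rm_swap X Y Z']
    simp [last X Y W Z Z' h]
  refine ext_inner_right ℝ fun w ↦ ?_
  obtain ⟨W, rfl⟩ := exists_field_apply w
  change inn (Rm X Y Z) W x = inn (Rm X' Y' Z') W x
  rw [third X Y Z Z' W hZ, inn_Rm_pair, last _ _ _ Y Y' hY, third _ _ X X' _ hX, ← inn_Rm_pair]

/-- The curvature on tangent vectors, defined through extensions that are smooth only near the
point, agrees with the curvature of global smooth fields. -/
theorem riemann_apply (X Y Z : VField I M) (x : M) :
    riemann I x (X x) (Y x) (Z x) = Rm X Y Z x := by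
  obtain ⟨X', hX⟩ := exists_field_extend (X x)
  obtain ⟨Y', hY⟩ := exists_field_extend (Y x)
  obtain ⟨Z', hZ⟩ := exists_field_extend (Z x)
  rw [riemann, ← curvatureField_eventuallyEq hX hY hZ]
  exact Rm_congr (by simpa using hX.self_of_nhds) (by simpa using hY.self_of_nhds)
    (by simpa using hZ.self_of_nhds)

theorem inner_riemann_swap (x : M) (u v w z : TangentSpace I x) :
    inner ℝ (riemann I x u v w) z = -inner ℝ (riemann I x u v z) w := by
  obtain ⟨X, rfl⟩ := exists_field_apply u
  obtain ⟨Y, rfl⟩ := exists_field_apply v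
  obtain ⟨Z, rfl⟩ := exists_field_apply w
  obtain ⟨W, rfl⟩ := exists_field_apply z
  simp only [riemann_apply]
  exact congrArg (fun f : SFun I M ↦ f x) (inn_Rm_swap X Y Z W)

theorem inner_riemann_pair (x : M) (u v w z : TangentSpace I x) :
    inner ℝ (riemann I x u v w) z = inner ℝ (riemann I x w z u) v := by
  obtain ⟨X, rfl⟩ := exists_field_apply u
  obtain ⟨Y, rfl⟩ := exists_field_apply v
  obtain ⟨Z, rfl⟩ := exists_field_apply w
  obtain ⟨W, rfl⟩ := exists_field_apply z
  simp only [riemann_apply]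
  exact congrArg (fun f : SFun I M ↦ f x) (inn_Rm_pair X Y Z W)

theorem riemann_swap (x : M) (u v w : TangentSpace I x) :
    riemann I x v u w = -riemann I x u v w := by
  obtain ⟨X, rfl⟩ := exists_field_apply u
  obtain ⟨Y, rfl⟩ := exists_field_apply v
  obtain ⟨Z, rfl⟩ := exists_field_apply w
  simp only [riemann_apply]
  exact congrArg (fun W : VField I M ↦ W x) (Rm_swap X Y Z)

theorem riemann_bianchi (x : M) (u v w : TangentSpace I x) :
    riemann I x u v w + riemann I x v w u + riemann I x w u v = 0 := by
  obtain ⟨X, rfl⟩ := exists_field_apply u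
  obtain ⟨Y, rfl⟩ := exists_field_apply v
  obtain ⟨Z, rfl⟩ := exists_field_apply w
  simp only [riemann_apply]
  exact congrArg (fun W : VField I M ↦ W x) (bianchi X Y Z)

theorem riemann_add_right (x : M) (u v w w' : TangentSpace I x) :
    riemann I x u v (w + w') = riemann I x u v w + riemann I x u v w' := by
  refine ext_inner_right ℝ fun z ↦ ?_
  rw [inner_add_left, inner_riemann_swap, inner_riemann_swap x u v w,
    inner_riemann_swap x u v w', inner_add_right]
  ring

theorem riemann_smul_right (x : M) (c : ℝ) (u v w : TangentSpace I x) :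
    riemann I x u v (c • w) = c • riemann I x u v w := by
  refine ext_inner_right ℝ fun z ↦ ?_
  rw [inner_smul_left, inner_riemann_swap, inner_riemann_swap x u v w, inner_smul_right]
  simp

theorem riemann_add_left (x : M) (u u' v w : TangentSpace I x) :
    riemann I x (u + u') v w = riemann I x u v w + riemann I x u' v w := by
  refine ext_inner_right ℝ fun z ↦ ?_
  rw [inner_add_left, inner_riemann_pair, riemann_add_right, inner_add_left,
    ← inner_riemann_pair, ← inner_riemann_pair x u' v w z]

theorem riemann_smul_left (x : M) (c : ℝ) (u v w : TangentSpace I x) :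
    riemann I x (c • u) v w = c • riemann I x u v w := by
  refine ext_inner_right ℝ fun z ↦ ?_
  rw [inner_smul_left, inner_riemann_pair, riemann_smul_right, inner_smul_left,
    ← inner_riemann_pair]

theorem riemann_add_middle (x : M) (u v v' w : TangentSpace I x) :
    riemann I x u (v + v') w = riemann I x u v w + riemann I x u v' w := by
  rw [riemann_swap x (v + v'), riemann_add_left, riemann_swap x u v, riemann_swap x u v']
  simp [add_comm]

theorem riemann_smul_middle (x : M) (c : ℝ) (u v w : TangentSpace I x) :
    riemann I x u (c • v) w = c • riemann I x u v w := by
  rw [riemann_swap x (c • v), riemann_smul_left, riemann_swap x u v]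
  simp

/-! ### Killing fields -/

/-- The Lie derivative `(L_V g)(X, Y)` as a smooth function. -/
def lie (V X Y : VField I M) : SFun I M :=
  der V (inn X Y) - inn (brk V X) Y - inn X (brk V Y)

theorem lie_apply (V X Y : VField I M) (x : M) :
    lie V X Y x = lieDerivMetric (fun y ↦ V y) (fun y ↦ X y) (fun y ↦ Y y) x := rfl

theorem lie_comm (V X Y : VField I M) : lie V X Y = lie V Y X := by
  simp only [lie, inn_comm X, inn_comm (brk V X)]
  ring

theorem lie_add_left (V X Y Z : VField I M) : lie V (X + Y) Z = lie V X Z + lie V Y Z := by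
  simp only [lie, inn_add_left, brk_add_right, der_add]
  ring

theorem lie_funSMul_left (V : VField I M) (f : SFun I M) (X Y : VField I M) :
    lie V (f • X) Y = f * lie V X Y := by
  simp only [lie, inn_add_left, inn_funSMul_left, brk_funSMul_right, der_mul]
  ring

theorem lie_eq_nab (V X Y : VField I M) :
    lie V X Y = inn (nab X V) Y + inn X (nab Y V) := by
  simp only [lie, der_inn, ← torsion_free, inn_sub_left, inn_sub_right]
  ring

/-- `L_[U, W] g = L_U L_W g - L_W L_U g`. -/
theorem lie_brk (U W X Y : VField I M) :
    lie (brk U W) X Y =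
      (der U (lie W X Y) - lie W (brk U X) Y - lie W X (brk U Y))
        - (der W (lie U X Y) - lie U (brk W X) Y - lie U X (brk W Y)) := by
  have h (Z : VField I M) : brk (brk U W) Z = brk U (brk W Z) - brk W (brk U Z) := by
    rw [jacobi U W Z]; abel
  simp only [lie, der_brk, h, der_sub, inn_sub_left, inn_sub_right]
  ring

theorem eq_zero_of_add_self {f : SFun I M} (h : f + f = 0) : f = 0 := by
  ext x
  have := congrArg (fun f : SFun I M ↦ f x) h
  simp at this
  simpa using this

/-- A Killing field: `L_K g = 0`. -/
def IsKilling (K : VField I M) : Prop := ∀ X Y, lie K X Y = 0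

theorem isKilling_brk {K L : VField I M} (hK : IsKilling K) (hL : IsKilling L) :
    IsKilling (brk K L) := by
  intro X Y
  simp [lie_brk, hK _ _, hL _ _]

/-- The flow of a Killing field preserves the Levi-Civita connection. The defect
`[K, ∇_X Y] - ∇_[K, X] Y - ∇_X [K, Y]` is symmetric in `X`, `Y` because the connection is
torsion-free, and paired with `Z` it is skew in `Y`, `Z` because the connection is metric. -/
theorem IsKilling.brk_nab {K : VField I M} (hK : IsKilling K) (X Y : VField I M) :
    brk K (nab X Y)
      = nab (brk K X) Y + nab X (brk K Y) := by
  let D (X Y : VField I M) : VField I M := brk K (nab X Y)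
    - nab (brk K X) Y - nab X (brk K Y)
  have symm (X Y) : D X Y = D Y X := by
    have h := jacobi K X Y
    rw [← torsion_free X Y, ← torsion_free _ Y, ← torsion_free X, brk_sub_right] at h
    simp only [D]
    rw [← sub_eq_zero] at h ⊢
    rw [← h]
    abel
  have skew (X Y Z) : inn (D X Y) Z = -inn (D X Z) Y := by
    have h1 := hK (nab X Y) Z
    have h2 := hK Y (nab X Z)
    have h3 := congrArg (der X) (hK Y Z)
    have h4 := der_brk K X (inn Y Z)
    rw [der_inn (brk K X), der_inn X Y Z, der_add] at h4
    rw [lie, der_sub, der_sub, der_inn X (brk K Y), der_inn X Y, der_zero] at h3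
    rw [lie] at h1 h2
    rw [inn_comm _ Y]
    simp only [D, inn_sub_left, inn_sub_right]
    linear_combination -h4 - h1 - h2 + h3
  have hD (Z) : inn (D X Y) Z = 0 := by
    apply eq_zero_of_add_self
    -- A trilinear form symmetric in two slots and skew in two overlapping ones vanishes.
    nth_rewrite 1 [skew, symm, skew, symm, skew, symm]
    ring
  have : D X Y = 0 := ext_inn fun Z ↦ by simp [hD]
  rw [← sub_eq_zero, ← this]
  simp only [D]
  abel

theorem IsKilling.brk_Rm {K : VField I M} (hK : IsKilling K) (X Y Z : VField I M) :
    brk K (Rm X Y Z) = Rm (brk K X) Y Z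
      + Rm X (brk K Y) Z + Rm X Y (brk K Z) := by
  simp only [Rm, brk_sub_right, hK.brk_nab, jacobi K X Y, nab_add_left, nab_add_right]
  abel

theorem IsKilling.der_inn_eq {K : VField I M} (hK : IsKilling K) (X Y : VField I M) :
    der K (inn X Y) = inn (brk K X) Y + inn X (brk K Y) := by
  have := hK X Y
  rw [lie] at this
  linear_combination this

theorem IsKilling.inn_nab {K : VField I M} (hK : IsKilling K) (X Y : VField I M) :
    inn (nab X K) Y = -inn (nab Y K) X := by
  have := hK X Y
  rw [lie_eq_nab, inn_comm X] at this
  linear_combination this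

end Pointwise

section SasakianIdentities

variable {E : Type*} [NormedAddCommGroup E] [NormedSpace ℝ E] [FiniteDimensional ℝ E]
  {H : Type*} [TopologicalSpace H] {I : ModelWithCorners ℝ E H}
  {M : Type*} [TopologicalSpace M] [ChartedSpace H M] [IsManifold I ∞ M]
  [RiemannianBundle (fun x : M ↦ TangentSpace I x)]
  [IsContMDiffRiemannianBundle I ∞ E (fun x : M ↦ TangentSpace I x)] [T2Space M]

namespace AlmostContactMetricStructure

variable (S : AlmostContactMetricStructure I M)

/-! ### Almost contact metric structures on smooth fields -/

/-- The characteristic form is metrically dual to `ξ`. -/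
theorem inner_ξ (x : M) (u : TangentSpace I x) : inner ℝ u (S.ξ x) = S.η x u := by
  have h := S.inner_φ_φ x u (S.ξ x)
  rw [S.φ_ξ, S.η_ξ, inner_zero_right] at h
  linarith

theorem inner_φ_left (x : M) (u v : TangentSpace I x) :
    inner ℝ (S.φ x u) v = -inner ℝ u (S.φ x v) := by
  have h := S.inner_φ_φ x (S.φ x u) v
  rw [S.φ_φ, S.η_φ, inner_add_left, inner_neg_left, inner_smul_left, real_inner_comm,
    real_inner_comm (S.φ x v) (S.ξ x), S.inner_ξ, S.η_φ] at h
  rw [real_inner_comm] at h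
  simp at h
  linarith

theorem contMDiff_φ (X : VField I M) :
    ContMDiff I (I.prod 𝓘(ℝ, E)) ∞ (T% (fun x ↦ S.φ x (X x))) :=
  ContMDiff.clm_bundle_apply (F₁ := E) (F₂ := E) (E₁ := fun x : M ↦ TangentSpace I x)
    (E₂ := fun x : M ↦ TangentSpace I x) S.smooth_φ X.contMDiff

/-- The field `φ X`. -/
def ph (X : VField I M) : VField I M := ⟨fun x ↦ S.φ x (X x), S.contMDiff_φ X⟩

/-- The characteristic field as a bundled smooth field. -/
def xi : VField I M := ⟨S.ξ, S.smooth_ξ⟩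

theorem ph_apply (X : VField I M) (x : M) : S.ph X x = S.φ x (X x) := rfl

theorem xi_apply (x : M) : S.xi x = S.ξ x := rfl

@[simp]
theorem ph_add (X Y : VField I M) : S.ph (X + Y) = S.ph X + S.ph Y := by
  ext x; simp [ph_apply]

@[simp]
theorem ph_funSMul (f : SFun I M) (X : VField I M) : S.ph (f • X) = f • S.ph X := by
  ext x; simp [ph_apply]

@[simp]
theorem ph_neg (X : VField I M) : S.ph (-X) = -S.ph X := by
  ext x; simp [ph_apply]

@[simp]
theorem ph_sub (X Y : VField I M) : S.ph (X - Y) = S.ph X - S.ph Y := by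
  ext x; simp [ph_apply]

@[simp]
theorem ph_zero : S.ph 0 = 0 := by
  ext x; simp [ph_apply]

@[simp]
theorem ph_xi : S.ph S.xi = 0 := by
  ext x; simp [ph_apply, xi_apply, S.φ_ξ]

@[simp]
theorem ph_ph (X : VField I M) : S.ph (S.ph X) = -X + inn X S.xi • S.xi := by
  ext x
  simp [ph_apply, inn_apply, xi_apply, S.φ_φ, S.inner_ξ]

@[simp]
theorem inn_xi_xi : inn S.xi S.xi = 1 := by
  ext x
  exact (S.inner_ξ x (S.ξ x)).trans (S.η_ξ x)

theorem inn_ph_left (X Y : VField I M) : inn (S.ph X) Y = -inn X (S.ph Y) := by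
  ext x; simp [inn_apply, ph_apply, S.inner_φ_left]

@[simp]
theorem inn_ph_xi (X : VField I M) : inn (S.ph X) S.xi = 0 := by
  simp [inn_ph_left]

@[simp]
theorem inn_xi_ph (X : VField I M) : inn S.xi (S.ph X) = 0 := by
  rw [inn_comm, inn_ph_xi]

theorem inn_ph_ph (X Y : VField I M) :
    inn (S.ph X) (S.ph Y) = inn X Y - inn X S.xi * inn Y S.xi := by
  rw [inn_ph_left, ph_ph]
  simp
  ring

variable {S}

/-! ### The covariant derivatives of `ξ` and `φ` -/

/-- The contact condition, with the factor `1/2` of `dη` cleared. -/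
theorem IsSasakian.contact_field (hS : S.IsSasakian) (X Y : VField I M) :
    der X (inn Y S.xi) - der Y (inn X S.xi) - inn (brk X Y) S.xi
      = inn X (S.ph Y) + inn X (S.ph Y) := by
  ext x
  have h := hS.contact (fun y ↦ X y) (fun y ↦ Y y) X.contMDiff Y.contMDiff x
  simp only [dη, ← S.inner_ξ] at h
  rw [div_eq_iff two_ne_zero, mul_two] at h
  exact h

theorem IsSasakian.normal_field (hS : S.IsSasakian) (X Y : VField I M) :
    S.ph (S.ph (brk X Y)) + brk (S.ph X) (S.ph Y) - S.ph (brk (S.ph X) Y)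
      - S.ph (brk X (S.ph Y)) + (inn X (S.ph Y) + inn X (S.ph Y)) • S.xi = 0 := by
  ext x
  have h := hS.normal (fun y ↦ X y) (fun y ↦ Y y) X.contMDiff Y.contMDiff x
  rw [hS.contact (fun y ↦ X y) (fun y ↦ Y y) X.contMDiff Y.contMDiff x, two_mul] at h
  exact h

theorem IsSasakian.der_xi_eta (hS : S.IsSasakian) (X : VField I M) :
    der S.xi (inn X S.xi) = inn (brk S.xi X) S.xi := by
  have h := hS.contact_field S.xi X
  simp at h
  linear_combination h

/-- `L_ξ φ = 0`. -/
theorem IsSasakian.brk_xi_ph (hS : S.IsSasakian) (X : VField I M) :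
    brk S.xi (S.ph X) = S.ph (brk S.xi X) := by
  have z (Y : VField I M) : brk 0 Y = 0 := by rw [brk_swap Y 0]; simp
  have h1 := hS.normal_field S.xi X
  simp only [ph_xi, z, ph_zero, inn_xi_ph, add_zero, zero_smul, add_zero, sub_zero] at h1
  have h2 := congrArg S.ph h1
  simp only [ph_sub, ph_ph, ph_add, ph_neg, ph_funSMul, ph_xi, smul_zero, add_zero, ph_zero] at h2
  have h3 := hS.der_xi_eta (S.ph X)
  simp only [inn_ph_xi, der_zero] at h3
  rw [← h3, zero_smul, add_zero] at h2
  rw [← sub_eq_zero, ← h2]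
  abel

/-- The characteristic field of a Sasakian structure is Killing. -/
theorem IsSasakian.isKilling_xi (hS : S.IsSasakian) : IsKilling S.xi := by
  have hxi (X) : lie S.xi X S.xi = 0 := by
    simp [lie, hS.der_xi_eta]
  -- `g(X, φY) = dη(X, Y)` is preserved by `ξ` because `L_ξ η = 0`, and so is `φ`.
  have hph (X Y) : lie S.xi X (S.ph Y) = 0 := by
    have h0 := hS.contact_field X Y
    have h1 := congrArg (der S.xi) h0
    have h2 := hS.contact_field (brk S.xi X) Y
    have h3 := hS.contact_field X (brk S.xi Y)
    have h4 := hS.der_xi_eta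
    have h5 := jacobi S.xi X Y
    have h6 := der_brk S.xi X (inn Y S.xi)
    have h7 := der_brk S.xi Y (inn X S.xi)
    simp only [der_sub, der_add, h4, h5, inn_add_left] at h1
    rw [h4] at h6 h7
    apply eq_zero_of_add_self
    rw [lie, hS.brk_xi_ph]
    linear_combination -h1 + h2 + h3 - h6 + h7
  intro X Y
  have hY : Y = (-1 : SFun I M) • S.ph (S.ph Y) + inn Y S.xi • S.xi := by
    rw [ph_ph]; module
  rw [lie_comm, hY, lie_add_left, lie_funSMul_left, lie_funSMul_left, lie_comm _ S.xi, hxi,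
    lie_comm _ _ X, hph]
  simp

theorem IsSasakian.nab_xi (hS : S.IsSasakian) (X : VField I M) : nab X S.xi = -S.ph X := by
  refine ext_inn fun Y ↦ ?_
  have h1 := hS.contact_field X Y
  have h2 := hS.isKilling_xi.inn_nab X Y
  rw [der_inn, der_inn, ← torsion_free, inn_sub_left, inn_comm Y, inn_comm X] at h1
  rw [inn_neg_left, inn_ph_left, neg_neg, ← sub_eq_zero]
  apply eq_zero_of_add_self
  linear_combination h1 + h2

/-- `(∇_X φ) Y = g(X, Y) ξ - η(Y) X`. For `G(X, Y, Z) = g((∇_X φ) Y - g(X, Y) ξ + η(Y) X, Z)` the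
normality condition and the vanishing of the cyclic sum of `G` combine to
`G(φX, Y, Z) + G(φY, Z, X) = G(φZ, X, Y)`; permuting cyclically, every term vanishes. -/
theorem IsSasakian.nab_ph (hS : S.IsSasakian) (X Y : VField I M) :
    nab X (S.ph Y) = S.ph (nab X Y) + inn X Y • S.xi - inn Y S.xi • X := by
  let D (X Y : VField I M) : VField I M :=
    nab X (S.ph Y) - S.ph (nab X Y) - inn X Y • S.xi + inn Y S.xi • X
  have hnx := hS.nab_xi
  have skew (X Y Z) : inn (D X Y) Z = -inn (D X Z) Y := by
    have h := congrArg (der X) (S.inn_ph_left Y Z)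
    rw [der_neg, der_inn, der_inn] at h
    have e := S.inn_ph_left (nab X Z) Y
    have e' := inn_comm (S.ph Y) (nab X Z)
    simp only [D, inn_add_left, inn_sub_left, inn_funSMul_left, inn_comm S.xi, e,
      S.inn_ph_left (nab X Y)]
    rw [inn_comm Y (nab X _)] at h
    linear_combination h - e'
  have hφ (X Y Z) : inn (D X (S.ph Y)) Z = inn (D X Y) (S.ph Z) := by
    have h := der_inn X Y S.xi
    rw [hnx, inn_neg_right, inn_comm Y (S.ph X), inn_ph_left] at h
    simp only [D, ph_ph, nab_add_right, nab_neg_right, nab_funSMul_right, hnx, inn_add_left,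
      inn_sub_left, inn_neg_left, inn_funSMul_left, S.inn_ph_ph, ph_xi, inn_zero_right, smul_neg, inn_xi_ph,
      inn_comm S.xi Z, S.inn_ph_left]
    linear_combination inn Z S.xi * h
  have hξ (X) : D X S.xi = 0 := by
    simp only [D, ph_xi, hnx, ph_neg, ph_ph, inn_xi_xi]
    have : nab X (0 : VField I M) = 0 := by simpa using nab_funSMul_right 0 X 0
    rw [this]
    module
  -- Since `φ = -∇ξ`, the part of `∇φ` antisymmetric in the first two slots is the curvature of `ξ`.
  have alt (X Y) : D X Y - D Y X = inn Y S.xi • X - inn X S.xi • Y - Rm X Y S.xi := by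
    simp only [D, Rm, hnx, nab_neg_right, ← torsion_free, ph_sub, inn_comm Y X]
    module
  have cyc (X Y Z) : inn (D X Y) Z + inn (D Y Z) X + inn (D Z X) Y = 0 := by
    have e (X Y Z) : inn (D X Y) Z + inn (D Y Z) X
        = inn Y S.xi * inn X Z - inn X S.xi * inn Y Z + inn (Rm X Y Z) S.xi := by
      have := congrArg (inn · Z) (alt X Y)
      simp only [inn_sub_left, inn_funSMul_left] at this
      rw [skew Y X, inn_Rm_swap] at this
      linear_combination this
    have b := congrArg (inn · S.xi) (bianchi X Y Z)
    simp only [inn_add_left, inn_zero_left] at b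
    apply eq_zero_of_add_self
    linear_combination e X Y Z + e Y Z X + e Z X Y + b - inn Z S.xi * inn_comm X Y
      - inn X S.xi * inn_comm Y Z - inn Y S.xi * inn_comm Z X
  have normal (X Y) : D (S.ph X) Y - D (S.ph Y) X - S.ph (D X Y) + S.ph (D Y X) = 0 := by
    have h := hS.normal_field X Y
    rw [← h]
    simp only [D, ← torsion_free, ph_sub, ph_add, ph_funSMul, ph_xi, smul_zero, inn_comm (S.ph Y) X,
      S.inn_ph_left X Y]
    module
  have key (X Y Z) : inn (D (S.ph X) Y) Z + inn (D (S.ph Y) Z) X = inn (D (S.ph Z) X) Y := by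
    have h := congrArg (inn · Z) (normal X Y)
    simp only [inn_sub_left, inn_add_left, inn_zero_left, inn_ph_left] at h
    have c := cyc X Y (S.ph Z)
    rw [skew Y (S.ph Z) X] at c
    linear_combination h - c + skew (S.ph Y) Z X
  -- Adding two of the three cyclic instances of `key` isolates a single term.
  have hD1 (X Y Z) : inn (D (S.ph X) Y) Z = 0 := by
    apply eq_zero_of_add_self
    linear_combination key X Y Z + key Z X Y
  have hD2 (Y Z) : inn (D S.xi Y) Z = 0 := by
    have := cyc S.xi Y Z
    rw [skew Y Z, hξ, hξ] at this
    simpa using this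
  have hD (X Y) : D X Y = 0 := by
    refine ext_inn fun Z ↦ ?_
    have h := hD1 (S.ph X) Y Z
    have e : D (S.ph (S.ph X)) Y = -D X Y + inn X S.xi • D S.xi Y := by
      simp only [D, ph_ph, nab_add_left, nab_neg_left, nab_funSMul_left, ph_add, ph_neg,
        ph_funSMul, inn_add_left, inn_neg_left, inn_funSMul_left]
      module
    rw [e, inn_add_left, inn_funSMul_left, hD2, inn_neg_left] at h
    rw [inn_zero_left]
    linear_combination -h
  have := hD X Y
  simp only [D] at this
  rw [← sub_eq_zero, ← this]
  abel

end AlmostContactMetricStructure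

end SasakianIdentities

section Traces

/-! ### Traces of bilinear forms -/

variable {F : Type*} [NormedAddCommGroup F] [InnerProductSpace ℝ F] {ι κ : Type*} [Fintype ι]
  [Fintype κ]

/-- The trace of a bilinear form does not depend on the orthonormal basis. -/
theorem sum_orthonormalBasis_eq (B : F →ₗ[ℝ] F →ₗ[ℝ] ℝ) (b : OrthonormalBasis ι ℝ F)
    (c : OrthonormalBasis κ ℝ F) : ∑ i, B (b i) (b i) = ∑ j, B (c j) (c j) := by
  have h1 (i) : B (b i) (b i) = ∑ j, inner ℝ (c j) (b i) * B (b i) (c j) := by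
    simpa using (congrArg (B (b i)) (c.sum_repr' (b i))).symm
  have h2 (j) : B (c j) (c j) = ∑ i, inner ℝ (b i) (c j) * B (b i) (c j) := by
    simpa using (congrArg (B · (c j)) (b.sum_repr' (c j))).symm
  simp only [h1, h2]
  rw [Finset.sum_comm]
  simp only [real_inner_comm]

/-- If the vectors `a i` have skew-symmetric coefficients in an orthonormal basis `b`, then
replacing `b` by `a` infinitesimally does not change the trace of a bilinear form. -/
theorem sum_skew_eq_zero (B : F →ₗ[ℝ] F →ₗ[ℝ] ℝ) (b : OrthonormalBasis ι ℝ F) (a : ι → F)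
    (ha : ∀ i j, inner ℝ (a i) (b j) = -inner ℝ (b i) (a j)) :
    ∑ i, (B (a i) (b i) + B (b i) (a i)) = 0 := by
  have h1 (i) : B (a i) (b i) = ∑ j, inner ℝ (b j) (a i) * B (b j) (b i) := by
    simpa using (congrArg (B · (b i)) (b.sum_repr' (a i))).symm
  have h2 (i) : B (b i) (a i) = ∑ j, inner ℝ (b j) (a i) * B (b i) (b j) := by
    simpa using (congrArg (B (b i)) (b.sum_repr' (a i))).symm
  rw [Finset.sum_add_distrib]
  simp only [h1, h2]
  rw [Finset.sum_comm, ← Finset.sum_add_distrib]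
  refine Finset.sum_eq_zero fun i _ ↦ ?_
  rw [← Finset.sum_add_distrib]
  refine Finset.sum_eq_zero fun j _ ↦ ?_
  rw [real_inner_comm, ha]
  ring

end Traces

section SasakianCurvature

variable {E : Type*} [NormedAddCommGroup E] [NormedSpace ℝ E] [FiniteDimensional ℝ E]
  {H : Type*} [TopologicalSpace H] {I : ModelWithCorners ℝ E H}
  {M : Type*} [TopologicalSpace M] [ChartedSpace H M] [IsManifold I ∞ M]
  [RiemannianBundle (fun x : M ↦ TangentSpace I x)]
  [IsContMDiffRiemannianBundle I ∞ E (fun x : M ↦ TangentSpace I x)] [T2Space M]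

theorem sum_apply {ι : Type*} (s : Finset ι) (f : ι → SFun I M) (x : M) :
    (∑ i ∈ s, f i) x = ∑ i ∈ s, f i x :=
  map_sum (AddMonoidHom.mk' (fun g : SFun I M ↦ g x) fun _ _ ↦ rfl) f s

namespace AlmostContactMetricStructure

variable {S : AlmostContactMetricStructure I M}

/-! ### Curvature of Sasakian manifolds -/

theorem IsSasakian.Rm_xi (hS : S.IsSasakian) (X Y : VField I M) :
    Rm X Y S.xi = inn Y S.xi • X - inn X S.xi • Y := by
  simp only [Rm, hS.nab_xi, nab_neg_right, hS.nab_ph, ← torsion_free, S.ph_sub, inn_comm Y X]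
  module

/-- The commutator of the curvature with `φ`, from differentiating the formula for `∇φ`. -/
theorem IsSasakian.Rm_ph (hS : S.IsSasakian) (X Y Z : VField I M) :
    Rm X Y (S.ph Z) = S.ph (Rm X Y Z) - inn Z (S.ph Y) • X + inn Z (S.ph X) • Y
      - inn Y Z • S.ph X + inn X Z • S.ph Y := by
  have hX := der_inn X Y Z
  have hY := der_inn Y X Z
  have hXZ := der_inn X Z S.xi
  have hYZ := der_inn Y Z S.xi
  simp only [Rm, hS.nab_ph, nab_add_right, nab_sub_right, nab_funSMul_right, hS.nab_xi,
    ← torsion_free, S.ph_sub, inn_sub_left, inn_neg_right] at hX hY hXZ hYZ ⊢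
  rw [hX, hY, hXZ, hYZ]
  module

theorem IsSasakian.riemann_ξ (hS : S.IsSasakian) (x : M) (u v : TangentSpace I x) :
    riemann I x u v (S.ξ x) = S.η x v • u - S.η x u • v := by
  obtain ⟨X, rfl⟩ := exists_field_apply u
  obtain ⟨Y, rfl⟩ := exists_field_apply v
  rw [← S.xi_apply, riemann_apply, hS.Rm_xi, ← S.inner_ξ, ← S.inner_ξ]
  rfl

theorem IsSasakian.riemann_φ (hS : S.IsSasakian) (x : M) (u v w : TangentSpace I x) :
    riemann I x u v (S.φ x w) = S.φ x (riemann I x u v w) - inner ℝ w (S.φ x v) • u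
      + inner ℝ w (S.φ x u) • v - inner ℝ v w • S.φ x u + inner ℝ u w • S.φ x v := by
  obtain ⟨X, rfl⟩ := exists_field_apply u
  obtain ⟨Y, rfl⟩ := exists_field_apply v
  obtain ⟨Z, rfl⟩ := exists_field_apply w
  rw [← S.ph_apply Z, riemann_apply, riemann_apply, hS.Rm_ph]
  rfl

/-! ### The `*`-Ricci tensor of a Sasakian manifold -/

/-- The bilinear form `(e, e') ↦ g(R(u, e)e', z)`. -/
def curvForm (x : M) (u z : TangentSpace I x) :
    TangentSpace I x →ₗ[ℝ] TangentSpace I x →ₗ[ℝ] ℝ :=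
  LinearMap.mk₂ ℝ (fun e e' ↦ inner ℝ (riemann I x u e e') z)
    (by intros; rw [riemann_add_middle, inner_add_left])
    (by intros; rw [riemann_smul_middle, inner_smul_left]; simp)
    (by intros; rw [riemann_add_right, inner_add_left])
    (by intros; rw [riemann_smul_right, inner_smul_left]; simp)

theorem starRicci_eq_sum {ι : Type*} [Fintype ι] (x : M) (u v : TangentSpace I x)
    (b : OrthonormalBasis ι ℝ (TangentSpace I x)) :
    S.starRicci x u v = ∑ i, inner ℝ (riemann I x u (b i) (S.φ x (b i))) (S.φ x v) := by
  exact sum_orthonormalBasis_eq ((curvForm x u (S.φ x v)).compl₂ (S.φ x).toLinearMap)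
    (stdOrthonormalBasis ℝ (TangentSpace I x)) b

/-- `Ric* = Ric - (m - 2) g - η ⊗ η` in dimension `m`. -/
theorem IsSasakian.starRicci_eq (hS : S.IsSasakian) (x : M) (u v : TangentSpace I x) :
    S.starRicci x u v = ricci I x u v - (Module.finrank ℝ E - 2 : ℝ) * inner ℝ u v
      - S.η x u * S.η x v := by
  set b := stdOrthonormalBasis ℝ (TangentSpace I x) with hb
  have term (i) : inner ℝ (riemann I x u (b i) (S.φ x (b i))) (S.φ x v)
      = inner ℝ (riemann I x (b i) u v) (b i)
        + (inner ℝ u (b i) * inner ℝ (b i) (S.ξ x) - S.η x u) * S.η x v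
        + inner ℝ (S.φ x u) (b i) * inner ℝ (b i) (S.φ x v) - inner ℝ (S.φ x u) (S.φ x v)
        - inner ℝ u (b i) * inner ℝ (b i) (S.φ x (S.φ x v)) := by
    have h1 : inner ℝ (b i) (b i) = (1 : ℝ) := by simp
    have h2 : inner ℝ (b i) (S.φ x (b i)) = (0 : ℝ) := by
      have := S.inner_φ_left x (b i) (b i)
      rw [real_inner_comm] at this
      linarith
    have h3 : S.η x (riemann I x u (b i) (b i))
        = S.η x u - inner ℝ u (b i) * inner ℝ (b i) (S.ξ x) := by
      rw [← S.inner_ξ, inner_riemann_swap, hS.riemann_ξ, inner_sub_left, inner_smul_left,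
        inner_smul_left, h1, S.inner_ξ]
      simp
      ring
    rw [hS.riemann_φ, h1, h2]
    simp only [inner_add_left, inner_sub_left, inner_smul_left, S.inner_φ_φ x (riemann I x u _ _),
      h3, inner_riemann_swap x u (b i) (b i) v, riemann_swap x u (b i) v, inner_neg_left]
    rw [S.inner_φ_left x (b i), real_inner_comm (S.φ x u) (b i)]
    simp
    ring
  rw [starRicci, ← hb]
  simp only [term, Finset.sum_add_distrib, Finset.sum_sub_distrib, ← Finset.sum_mul,
    b.sum_inner_mul_inner]
  rw [ricci, ← hb, S.inner_ξ, show inner ℝ u (S.φ x (S.φ x v)) = -inner ℝ (S.φ x u) (S.φ x v) by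
    rw [S.inner_φ_left, neg_neg], S.inner_φ_φ]
  have hfr : Module.finrank ℝ (TangentSpace I x) = Module.finrank ℝ E := rfl
  simp [hfr]
  ring

variable (S) in
/-- A second contraction for `Ric*`, by the first Bianchi identity and the skew-symmetry of `φ`. -/
theorem two_mul_starRicci (x : M) (u v : TangentSpace I x) :
    2 * S.starRicci x u v = -∑ i, inner ℝ (riemann I x (stdOrthonormalBasis ℝ (TangentSpace I x) i)
      (S.φ x (stdOrthonormalBasis ℝ (TangentSpace I x) i)) u) (S.φ x v) := by
  set b := stdOrthonormalBasis ℝ (TangentSpace I x) with hb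
  have h := sum_skew_eq_zero (curvForm x u (S.φ x v)) b (fun i ↦ S.φ x (b i))
    (fun i j ↦ S.inner_φ_left x _ _)
  have e (i) : inner ℝ (riemann I x (b i) (S.φ x (b i)) u) (S.φ x v)
      = curvForm x u (S.φ x v) (S.φ x (b i)) (b i)
        - curvForm x u (S.φ x v) (b i) (S.φ x (b i)) := by
    have := congrArg (inner ℝ · (S.φ x v)) (riemann_bianchi x u (b i) (S.φ x (b i)))
    simp only [inner_add_left, inner_zero_left, riemann_swap x u (S.φ x (b i)), inner_neg_left]
      at this
    simp only [curvForm, LinearMap.mk₂_apply]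
    linarith
  have e' : S.starRicci x u v = ∑ i, curvForm x u (S.φ x v) (b i) (S.φ x (b i)) := rfl
  simp only [e]
  rw [Finset.sum_add_distrib] at h
  rw [Finset.sum_sub_distrib, e']
  linarith

/-- `Ric*` is `φ`-invariant: in the contraction `-½ ∑ g(R(eᵢ, φeᵢ)u, φv)` one may commute `φ` with the
curvature, because the traces of the correction terms cancel. -/
theorem IsSasakian.starRicci_φ_φ (hS : S.IsSasakian) (x : M) (u v : TangentSpace I x) :
    S.starRicci x (S.φ x u) (S.φ x v) = S.starRicci x u v := by
  have h1 := S.two_mul_starRicci x u v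
  have h2 := S.two_mul_starRicci x (S.φ x u) (S.φ x v)
  set b := stdOrthonormalBasis ℝ (TangentSpace I x)
  have e (i) : inner ℝ (riemann I x (b i) (S.φ x (b i)) (S.φ x u)) (S.φ x (S.φ x v))
      = inner ℝ (riemann I x (b i) (S.φ x (b i)) u) (S.φ x v)
        - inner ℝ (S.φ x (S.φ x u)) (b i) * inner ℝ (b i) (S.φ x (S.φ x v))
        + inner ℝ u (b i) * inner ℝ (b i) (S.φ x (S.φ x (S.φ x (S.φ x v)))) := by
    rw [hS.riemann_φ]
    simp only [inner_add_left, inner_sub_left, inner_smul_left,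
      S.inner_φ_φ x (riemann I x _ _ u), S.η_φ]
    have e1 : inner ℝ u (S.φ x (S.φ x (b i))) = inner ℝ (S.φ x (S.φ x u)) (b i) := by
      rw [S.inner_φ_left, S.inner_φ_left, neg_neg]
    have e2 : inner ℝ (S.φ x (S.φ x (b i))) (S.φ x (S.φ x v))
        = inner ℝ (b i) (S.φ x (S.φ x (S.φ x (S.φ x v)))) := by
      rw [S.inner_φ_left, S.inner_φ_left, neg_neg]
    rw [e1, e2, real_inner_comm u (b i), real_inner_comm u (S.φ x (b i))]
    simp
  simp only [e, Finset.sum_add_distrib, Finset.sum_sub_distrib, b.sum_inner_mul_inner] at h2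
  have e3 : inner ℝ (S.φ x (S.φ x u)) (S.φ x (S.φ x v))
        = inner ℝ u (S.φ x (S.φ x (S.φ x (S.φ x v)))) := by
    rw [S.inner_φ_left, S.inner_φ_left, neg_neg]
  rw [e3] at h2
  linarith

/-- The characteristic field preserves the `*`-Ricci tensor. In a local orthonormal frame `(eᵢ)`
the brackets `[ξ, eᵢ]` have skew-symmetric coefficients, hence do not contribute to the trace. -/
theorem IsSasakian.der_xi_starRicci (hS : S.IsSasakian) (X Y : VField I M) (f : SFun I M)
    (hf : ∀ y, f y = S.starRicci y (X y) (Y y)) (x : M) :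
    der S.xi f x = S.starRicci x (brk S.xi X x) (Y x) + S.starRicci x (X x) (brk S.xi Y x) := by
  obtain ⟨e, he⟩ := exists_orthonormal_frame (I := I) x
  have hK := hS.isKilling_xi
  have h1 : (f : M → ℝ) =ᶠ[𝓝 x] (∑ i, inn (Rm X (e i) (S.ph (e i))) (S.ph Y) : SFun I M) := by
    filter_upwards [he] with y hy
    rw [hf, starRicci_eq_sum y _ _ (frameBasis hy)]
    have hsum : (∑ i, inn (Rm X (e i) (S.ph (e i))) (S.ph Y) : SFun I M) y
        = ∑ i, inn (Rm X (e i) (S.ph (e i))) (S.ph Y) y := sum_apply ..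
    rw [hsum]
    refine Finset.sum_congr rfl fun i _ ↦ ?_
    rw [frameBasis_apply, ← S.ph_apply, ← S.ph_apply, riemann_apply]
    rfl
  have h2 (i) : der S.xi (inn (Rm X (e i) (S.ph (e i))) (S.ph Y)) x
      = inner ℝ (riemann I x (brk S.xi X x) (e i x) (S.φ x (e i x))) (S.φ x (Y x))
        + inner ℝ (riemann I x (X x) (e i x) (S.φ x (e i x))) (S.φ x (brk S.xi Y x))
        + (curvForm x (X x) (S.φ x (Y x)) (brk S.xi (e i) x) (S.φ x (e i x))
          + curvForm x (X x) (S.φ x (Y x)) (e i x) (S.φ x (brk S.xi (e i) x))) := by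
    rw [hK.der_inn_eq, hK.brk_Rm, hS.brk_xi_ph, hS.brk_xi_ph]
    simp only [inn_add_left, curvForm, LinearMap.mk₂_apply]
    simp only [← S.ph_apply, riemann_apply]
    simp [inn_apply]
    ring
  have hb := he.self_of_nhds
  have hskew (i j) : inner ℝ (brk S.xi (e i) x) (e j x) = -inner ℝ (e i x) (brk S.xi (e j) x) := by
    have h3 : (inn (e i) (e j) : M → ℝ) =ᶠ[𝓝 x]
        (algebraMap ℝ (SFun I M) (if i = j then 1 else 0)) := by
      filter_upwards [he] with y hy
      exact orthonormal_iff_ite.1 hy i j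
    have h4 := der_congr S.xi h3
    rw [hK.der_inn_eq, der_algebraMap] at h4
    exact eq_neg_of_add_eq_zero_left h4
  have h5 := sum_skew_eq_zero ((curvForm x (X x) (S.φ x (Y x))).compl₂ (S.φ x).toLinearMap)
    (frameBasis hb) (fun i ↦ brk S.xi (e i) x) (by simpa using hskew)
  simp only [frameBasis_apply, LinearMap.compl₂_apply, ContinuousLinearMap.coe_coe] at h5
  rw [der_congr _ h1, der_sum]
  have hsum : (∑ i, der S.xi (inn (Rm X (e i) (S.ph (e i))) (S.ph Y)) : SFun I M) x
      = ∑ i, der S.xi (inn (Rm X (e i) (S.ph (e i))) (S.ph Y)) x := sum_apply ..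
  rw [hsum, Finset.sum_congr rfl fun i _ ↦ h2 i, Finset.sum_add_distrib, h5, add_zero,
    Finset.sum_add_distrib, starRicci_eq_sum x _ _ (frameBasis hb),
    starRicci_eq_sum x _ _ (frameBasis hb)]
  simp only [frameBasis_apply]

end AlmostContactMetricStructure

end SasakianCurvature

section Soliton

variable {E : Type*} [NormedAddCommGroup E] [NormedSpace ℝ E] [FiniteDimensional ℝ E]
  {H : Type*} [TopologicalSpace H] {I : ModelWithCorners ℝ E H}
  {M : Type*} [TopologicalSpace M] [ChartedSpace H M] [IsManifold I ∞ M]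
  [RiemannianBundle (fun x : M ↦ TangentSpace I x)]
  [IsContMDiffRiemannianBundle I ∞ E (fun x : M ↦ TangentSpace I x)] [T2Space M]

namespace AlmostContactMetricStructure

variable {S : AlmostContactMetricStructure I M}

/-! ### Sasakian `*`-Ricci solitons -/

/-- On a `*`-Ricci soliton the `*`-Ricci tensor of two smooth fields is a smooth function, because
it is expressed by `L_V g` and `g`. -/
theorem exists_starRicci_field {V : VField I M} {c : ℝ}
    (hV : S.IsStarRicciSoliton (fun x ↦ V x) c) :
    ∃ R : VField I M → VField I M → SFun I M,
      (∀ X Y x, R X Y x = S.starRicci x (X x) (Y x)) ∧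
      ∀ X Y, lie V X Y = -(R X Y + R X Y)
        - (algebraMap ℝ (SFun I M) c + algebraMap ℝ (SFun I M) c) * inn X Y := by
  refine ⟨fun X Y ↦ (-1 / 2 : ℝ) • lie V X Y - c • inn X Y, fun X Y x ↦ ?_, fun X Y ↦ ?_⟩
  · have h := hV.2 (fun y ↦ X y) (fun y ↦ Y y) X.contMDiff Y.contMDiff x
    rw [← lie_apply, ← inn_apply] at h
    change (-1 / 2 : ℝ) * lie V X Y x - c * inn X Y x = _
    linarith
  · rw [← map_add, ← Algebra.smul_def]
    module

/-! In the following lemmas `R` is the `*`-Ricci tensor on smooth fields and `c` is the constant of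
the soliton, viewed as a constant function. -/

variable {V : VField I M} {R : VField I M → VField I M → SFun I M} {c : SFun I M}

/-- The commutator of the potential field and the characteristic field is Killing. -/
theorem IsSasakian.isKilling_brk_potential (hS : S.IsSasakian)
    (hR : ∀ X Y x, R X Y x = S.starRicci x (X x) (Y x)) (hc : ∀ X, der X c = 0)
    (hV : ∀ X Y, lie V X Y = -(R X Y + R X Y) - (c + c) * inn X Y) :
    IsKilling (brk V S.xi) := by
  intro X Y
  have hK := hS.isKilling_xi
  have h : der S.xi (R X Y) = R (brk S.xi X) Y + R X (brk S.xi Y) := by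
    ext x
    rw [hS.der_xi_starRicci X Y _ (hR X Y) x]
    simp [hR]
  rw [lie_brk, hK, hK, hK, hV, hV, hV]
  simp only [der_sub, der_neg, der_add, der_mul, der_zero, h, hK.der_inn_eq, hc]
  ring

theorem R_xi (hR : ∀ X Y x, R X Y x = S.starRicci x (X x) (Y x)) (X : VField I M) :
    R X S.xi = 0 := by
  ext x
  simp [hR, starRicci, xi_apply, S.φ_ξ]

theorem inn_brk_xi (hR : ∀ X Y x, R X Y x = S.starRicci x (X x) (Y x))
    (hV : ∀ X Y, lie V X Y = -(R X Y + R X Y) - (c + c) * inn X Y) :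
    inn (brk V S.xi) S.xi = c := by
  have h := hV S.xi S.xi
  rw [R_xi hR, lie, inn_xi_xi, der_one, inn_comm S.xi] at h
  rw [← sub_eq_zero]
  apply eq_zero_of_add_self
  linear_combination -h

/-- `∇_ξ A = φA` for `A = [V, ξ]`, since `A` is Killing and `g(A, ξ)` is constant. -/
theorem IsSasakian.nab_xi_brk (hS : S.IsSasakian)
    (hR : ∀ X Y x, R X Y x = S.starRicci x (X x) (Y x)) (hc : ∀ X, der X c = 0)
    (hV : ∀ X Y, lie V X Y = -(R X Y + R X Y) - (c + c) * inn X Y) :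
    nab S.xi (brk V S.xi) = S.ph (brk V S.xi) := by
  refine ext_inn fun Y ↦ ?_
  have h1 := der_inn Y (brk V S.xi) S.xi
  rw [inn_brk_xi hR hV, hc, hS.nab_xi, inn_neg_right] at h1
  rw [(hS.isKilling_brk_potential hR hc hV).inn_nab, inn_ph_left]
  linear_combination h1

/-- The rotated field `φ [V, ξ] = [ξ, [V, ξ]] / 2` is again Killing; this is that statement with
the covariant derivative of `φ` written out. -/
theorem IsSasakian.inn_ph_nab_brk (hS : S.IsSasakian)
    (hR : ∀ X Y x, R X Y x = S.starRicci x (X x) (Y x)) (hc : ∀ X, der X c = 0)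
    (hV : ∀ X Y, lie V X Y = -(R X Y + R X Y) - (c + c) * inn X Y) (X Y : VField I M) :
    inn (S.ph (nab X (brk V S.xi))) Y + inn X (S.ph (nab Y (brk V S.xi)))
      + inn X (brk V S.xi) * inn Y S.xi + inn Y (brk V S.xi) * inn X S.xi
      = (c + c) * inn X Y := by
  have hA := hS.isKilling_brk_potential hR hc hV
  have hn := hS.nab_xi_brk hR hc hV
  have hi := inn_brk_xi hR hV
  set A := brk V S.xi
  have hb : brk S.xi A = S.ph A + S.ph A := by
    rw [← torsion_free, hn, hS.nab_xi]
    abel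
  have h := isKilling_brk hS.isKilling_xi hA X Y
  rw [hb, lie_eq_nab] at h
  simp only [nab_add_right, hS.nab_ph, inn_add_left, inn_add_right, inn_sub_left, inn_sub_right,
    inn_funSMul_left, inn_funSMul_right, hi, inn_comm S.xi] at h
  rw [← sub_eq_zero]
  apply eq_zero_of_add_self
  linear_combination h

/-- The Lie derivative of `φ` along the potential field, computed from `L_V dη = d (L_V η)`. -/
theorem IsSasakian.inn_lie_ph (hS : S.IsSasakian)
    (hR : ∀ X Y x, R X Y x = S.starRicci x (X x) (Y x)) (hc : ∀ X, der X c = 0)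
    (hV : ∀ X Y, lie V X Y = -(R X Y + R X Y) - (c + c) * inn X Y) (X Y : VField I M) :
    inn X (brk V (S.ph Y) - S.ph (brk V Y))
      = inn (nab X (brk V S.xi)) Y + R X (S.ph Y) + R X (S.ph Y) := by
  have hA := hS.isKilling_brk_potential hR hc hV
  -- This is `L_V η = g(A, ·) - 2λη`, the soliton equation paired with `ξ`.
  have hα (Z : VField I M) : der V (inn Z S.xi)
      = inn (brk V Z) S.xi + inn Z (brk V S.xi) - (c + c) * inn Z S.xi := by
    have h := hV Z S.xi
    rw [R_xi hR, lie] at h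
    linear_combination h
  set A := brk V S.xi
  have h0 := hS.contact_field X Y
  have h1 := congrArg (der V) h0
  have h2 := hS.contact_field (brk V X) Y
  have h3 := hS.contact_field X (brk V Y)
  have h4 := jacobi V X Y
  have h5 := der_brk V X (inn Y S.xi)
  have h6 := der_brk V Y (inn X S.xi)
  have h7 := hV X (S.ph Y)
  have h8 := hA.inn_nab X Y
  rw [hα] at h5 h6
  simp only [der_add, der_sub, der_mul, hc, der_inn X Y A, der_inn Y X A] at h5 h6
  simp only [der_sub, der_add, hα, h4, inn_add_left] at h1
  have h9 := congrArg (inn · A) (torsion_free X Y)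
  simp only [inn_sub_left] at h9
  rw [lie] at h7
  rw [inn_sub_right, ← sub_eq_zero]
  apply eq_zero_of_add_self
  linear_combination -h1 + h2 + h3 - 2 * h7 - h5 + h6 - (c + c) * h0 - h8 + h9
    + inn_comm Y (nab X A) - inn_comm X (nab Y A)

/-- `2 Ric* = -λ (g - η ⊗ η)`, obtained by taking the Lie derivative of
`g(φX, φY) = g(X, Y) - η(X) η(Y)` along the potential field. -/
theorem IsSasakian.two_mul_R (hS : S.IsSasakian)
    (hR : ∀ X Y x, R X Y x = S.starRicci x (X x) (Y x)) (hc : ∀ X, der X c = 0)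
    (hV : ∀ X Y, lie V X Y = -(R X Y + R X Y) - (c + c) * inn X Y) (X Y : VField I M) :
    R X Y + R X Y = -c * (inn X Y - inn X S.xi * inn Y S.xi) := by
  have hA := hS.isKilling_brk_potential hR hc hV
  have hφ (X Y) : R (S.ph X) (S.ph Y) = R X Y := by
    ext x
    rw [hR, hR, ph_apply, ph_apply, hS.starRicci_φ_φ]
  have hsymm (X Y) : R X Y = R Y X := by
    have h := lie_comm V X Y
    rw [hV, hV, inn_comm Y X] at h
    rw [← sub_eq_zero]
    apply eq_zero_of_add_self
    linear_combination -h
  -- This is `L_V η = g(A, ·) - 2λη`, the soliton equation paired with `ξ`.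
  have hα (Z : VField I M) : der V (inn Z S.xi)
      = inn (brk V Z) S.xi + inn Z (brk V S.xi) - (c + c) * inn Z S.xi := by
    have h := hV Z S.xi
    rw [R_xi hR, lie] at h
    linear_combination h
  have h1 := congrArg (der V) (S.inn_ph_ph X Y)
  have h2 := hV (S.ph X) (S.ph Y)
  have h3 := hV X Y
  have h4 := hS.inn_lie_ph hR hc hV (S.ph X) Y
  have h5 := hS.inn_lie_ph hR hc hV (S.ph Y) X
  have h6 := hS.inn_ph_nab_brk hR hc hV X Y
  have h7 := S.inn_ph_ph X Y
  have h8 := S.inn_ph_ph (brk V X) Y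
  have h9 := S.inn_ph_ph X (brk V Y)
  rw [hA.inn_nab, hφ, inn_sub_right] at h4 h5
  rw [hsymm Y X] at h5
  simp only [der_sub, der_mul, hα] at h1
  rw [lie, hφ] at h2
  rw [lie] at h3
  have h10 := S.inn_ph_left X (nab Y (brk V S.xi))
  have h11 := S.inn_ph_left (nab X (brk V S.xi)) Y
  rw [inn_comm (S.ph X)] at h10
  rw [inn_comm (S.ph Y), inn_comm (S.ph Y)] at h5
  rw [← sub_eq_zero]
  apply eq_zero_of_add_self
  linear_combination -h2 + h1 + h3 - h4 - h5 - h6 + (c + c) * h7 - h8 - h9 + h10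
    + h11

/-- The Jacobi equation along `ξ`. -/
theorem IsSasakian.nab_xi_nab_xi (hS : S.IsSasakian)
    (hR : ∀ X Y x, R X Y x = S.starRicci x (X x) (Y x)) (hc : ∀ X, der X c = 0)
    (hV : ∀ X Y, lie V X Y = -(R X Y + R X Y) - (c + c) * inn X Y) :
    nab S.xi (nab S.xi V) + Rm V S.xi S.xi = 0 := by
  have h1 : nab S.xi V = -S.ph V - brk V S.xi := by
    rw [← torsion_free, hS.nab_xi]; abel
  rw [h1, nab_sub_right, nab_neg_right, hS.nab_xi_brk hR hc hV, hS.nab_ph, h1, hS.Rm_xi]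
  simp only [S.ph_sub, S.ph_neg, ph_ph, inn_xi_xi, inn_comm S.xi]
  module

/-- A Sasakian `*`-Ricci soliton is `η`-Einstein, and its potential field is a Jacobi field along
the integral curves of `ξ`. -/
theorem IsSasakian.starRicciSoliton (hS : S.IsSasakian) {V : Π x : M, TangentSpace I x} {lam : ℝ}
    (hV : S.IsStarRicciSoliton V lam) :
    IsJacobiAlong S.ξ V ∧
      S.IsEtaEinsteinWith ((Module.finrank ℝ E : ℝ) - 2 - lam / 2) (1 + lam / 2) := by
  set W : VField I M := ⟨V, hV.1⟩
  set c := algebraMap ℝ (SFun I M) lam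
  obtain ⟨R, hR, hW⟩ := exists_starRicci_field (V := W) hV
  have hc (X : VField I M) : der X c = 0 := der_algebraMap X lam
  refine ⟨⟨fun x ↦ ?_, fun x ↦ ?_⟩, fun x u v ↦ ?_⟩
  · have h := hS.nab_xi S.xi
    rw [ph_xi, neg_zero] at h
    exact congrArg (fun X : VField I M ↦ X x) h
  · have h := congrArg (fun X : VField I M ↦ X x) (hS.nab_xi_nab_xi hR hc hW)
    change nab S.xi (nab S.xi W) x + riemann I x (W x) (S.xi x) (S.xi x) = 0
    rw [riemann_apply]
    exact h
  · obtain ⟨X, rfl⟩ := exists_field_apply u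
    obtain ⟨Y, rfl⟩ := exists_field_apply v
    have h := congrArg (fun f : SFun I M ↦ f x) (hS.two_mul_R hR hc hW X Y)
    have h' : R X Y x + R X Y x
        = -lam * (inner ℝ (X x) (Y x) - inner ℝ (X x) (S.ξ x) * inner ℝ (Y x) (S.ξ x)) := h
    rw [hR, hS.starRicci_eq, S.inner_ξ, S.inner_ξ] at h'
    linarith

end AlmostContactMetricStructure

end Soliton

end

end SasakianGeometry

theorem mainTheorem2 (n : ℕ)
    (M : Type*) [TopologicalSpace M] [T2Space M]
    [ChartedSpace (EuclideanSpace ℝ (Fin (2 * n + 1))) M]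
    [IsManifold (𝓡 (2 * n + 1)) ∞ M]
    [RiemannianBundle (fun x : M ↦ TangentSpace (𝓡 (2 * n + 1)) x)]
    [IsContMDiffRiemannianBundle (𝓡 (2 * n + 1)) ∞ (EuclideanSpace ℝ (Fin (2 * n + 1)))
      (fun x : M ↦ TangentSpace (𝓡 (2 * n + 1)) x)]
    (S : SasakianGeometry.AlmostContactMetricStructure (𝓡 (2 * n + 1)) M) (hS : S.IsSasakian)
    (V : Π x : M, TangentSpace (𝓡 (2 * n + 1)) x) (lam : ℝ)
    (hV : S.IsStarRicciSoliton V lam) :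
    SasakianGeometry.IsJacobiAlong S.ξ V ∧
      S.IsEtaEinstein ∧
        S.IsEtaEinsteinWith (2 * (n : ℝ) - 1 - lam / 2) (1 + lam / 2) := by
  obtain ⟨h1, h2⟩ := hS.starRicciSoliton hV
  have hdim : (Module.finrank ℝ (EuclideanSpace ℝ (Fin (2 * n + 1))) : ℝ) - 2 - lam / 2
      = 2 * (n : ℝ) - 1 - lam / 2 := by
    rw [finrank_euclideanSpace_fin]
    push_cast
    ring
  rw [hdim] at h2
  exact ⟨h1, ⟨_, _, h2⟩, h2⟩
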